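/- **Model.** There are $N$ nodes, $M$ classes of functions and $K\ge 1$ resource types; node $i$ has a known capacity $\beta_{i,k}\in(0,\infty]$ of resource $k$. In each slot $t=1,2,\dots$ a function of class $j(t)$ arrives, with $\mathbb P(j(t)=j)=\lambda_j$, and is placed in a node $i(t)$. Placing a class-$j$ function in node $i$ at time $t$ costs $C_{i,j}(t)\in[0,1]$, with mean $c_{i,j}$, and uses an amount $A_{i,j,k}(t)\in[0,\beta_{i,k}]$ of resource $k$, with mean $a_{i,j,k}$. For all $i,j,k$ the laws of $j(t)$, $C_{i,j}(t)$, $A_{i,j,k}(t)$ do not depend on $t$; $(j(t),C(t),A(t))$ is independent of everything generated before slot $t$, and $j(t)$ is independent of $(C(t),A(t))$ (costs and requirements of the same slot may be correlated with each other). One class is a null class (no arrival), with zero cost and zero resource requirement; one node is a rejection node, with $\beta_{i,k}=\infty$ for all $k$ and with cost $c_{i,j}=1$ for all non-null $j$. Put $\kappa_{i,j,k}=\lambda_j a_{i,j,k}/\beta_{i,k}$ (so $\kappa_{i,j,k}=0$ if $\beta_{i,k}=\infty$), $$f(p,c,\lambda)=\sum_{i,j}p_{i,j}\lambda_jc_{i,j},\qquad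 g_{i,k}(p,\kappa)=\sum_j p_{i,j}\kappa_{i,j,k},\qquad \Delta=\Big\{p\in[0,1]^{N\times M}:\sum_i p_{i,j}=1\ \forall j\Big\}.$$ Let $p^\star$ minimize $f(p,c,\lambda)$ over $p\in\Delta$ with $\max_{i,k}g_{i,k}(p,\kappa)\le 1$. **Algorithm.** Let $D(x,y)$ be the relative entropy between Bernoulli laws of means $x,y$. Let $n_{j}(t)$, resp. $n_{i,j}(t)$, be the number of slots $s<t$ with $j(s)=j$, resp. with $j(s)=j$ and $i(s)=i$. Let $$\hat\lambda_j(t)=\frac{n_j(t)}{t-1},\quad \hat c_{i,j}(t)=\frac{1}{n_{i,j}(t)}\sum_{s<t,\,j(s)=j,\,i(s)=i}C_{i,j}(s),\quad \hat\kappa_{i,j,k}(t)=\frac1{t-1}\sum_{s<t,\,j(s)=j}\frac{A_{i,j,k}(s)}{\beta_{i,k}}$$ (an estimate without observations is $0$), and $$\lambda_j^-(t)=\min\{y\in[0,1]:tD(\hat\lambda_j(t),y)\le\ln t\},\qquad c_{i,j}^-(t)=\min\{y\in[0,1]:n_{i,j}(t)D(\hat c_{i,j}(t),y)\le\ln t\},$$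 $$\kappa_{i,j,k}^+(t)=\max\{y\in[0,1]:tD(\hat\kappa_{i,j,k}(t),y)\le\ln t\}\ \text{ if }\beta_{i,k}<\infty,\qquad \kappa_{i,j,k}^+(t)=0\ \text{ if }\beta_{i,k}=\infty.$$ At each slot $t$ the learner chooses, from the information generated before slot $t$, a minimizer $\hat p(t)$ of $f(p,c^-(t),\lambda^-(t))$ over $p\in\Delta$ with $\max_{i,k}g_{i,k}(p,\kappa^+(t))\le1$, and draws $i(t)$ so that, conditionally on the past and on $j(t),C(t),A(t)$, $i(t)=i$ has probability $\hat p_{i,j(t)}(t)$. **Theorem.** Let $R(T)=\sum_{t=1}^T\mathbb E\big(f(\hat p(t),c,\lambda)-f(p^\star,c,\lambda)\big)$. For every $T\ge1$, $$\frac{R(T)}{T}\le\frac{NM}{T}\Big[2(\sqrt2+1)\sqrt{T\ln T}+6K(1+\ln T)\Big],$$ and $R(T)=O(NM\sqrt{T\ln T})$ as $T\to\infty$, with an absolute constant in the $O$ (while the time from which the bound holds may depend on the system). Moreover, for every $T\ge2$, $$\mathbb P\Big(\max_{i,k}g_{i,k}(\hat p(T),\kappa)\le1\Big)\ge1-6NMK\,\frac{\ln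 T}{T},$$ and this probability tends to $1$ as $T\to\infty$. -/

import Mathlib

open MeasureTheory ProbabilityTheory
open scoped ENNReal

namespace Placement

/-- Relative entropy `D(x, y)` between Bernoulli laws with means `x, y ∈ [0,1]`, with the usual
conventions `0 ln 0 = 0` and `D(x, y) = ∞` when the first law is not absolutely continuous with
respect to the second. -/
noncomputable def bernKL (x y : ℝ) : ℝ≥0∞ :=
  if (y = 0 ∧ x ≠ 0) ∨ (y = 1 ∧ x ≠ 1) then ⊤
  else ENNReal.ofReal (x * Real.log (x / y) + (1 - x) * Real.log ((1 - x) / (1 - y)))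

/-- The means `y ∈ [0,1]` that are plausible at time `t` for an empirical mean `x` of
weight `w`: those with `w D(x, y) ≤ ln t`. -/
def plausible (w t : ℕ) (x : ℝ) : Set ℝ :=
  {y : ℝ | y ∈ Set.Icc (0 : ℝ) 1 ∧ (w : ℝ≥0∞) * bernKL x y ≤ ENNReal.ofReal (Real.log t)}

/-- Lower confidence bound, the least plausible mean. -/
noncomputable def lcb (w t : ℕ) (x : ℝ) : ℝ := sInf (plausible w t x)

/-- Upper confidence bound, the greatest plausible mean. -/
noncomputable def ucb (w t : ℕ) (x : ℝ) : ℝ := sSup (plausible w t x)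

/-- The set of strategies: `p i j` is the probability of placing class `j` at node `i`. -/
def strategies (N M : ℕ) : Set (Fin N → Fin M → ℝ) :=
  {p | (∀ i j, p i j ∈ Set.Icc (0 : ℝ) 1) ∧ ∀ j, ∑ i, p i j = 1}

/-- The mean cost `f(p, c, λ)`. -/
def meanCost {N M : ℕ} (p c : Fin N → Fin M → ℝ) (lam : Fin M → ℝ) : ℝ :=
  ∑ i, ∑ j, p i j * lam j * c i j

/-- The normalized load `g_{i,k}(p, κ)`. -/
def load {N M K : ℕ} (p : Fin N → Fin M → ℝ) (kap : Fin N → Fin M → Fin K → ℝ)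
    (i : Fin N) (k : Fin K) : ℝ :=
  ∑ j, p i j * kap i j k

/-- `p` solves the placement linear program: it minimizes `f(p, c, λ)` over the strategies with
`max_{i,k} g_{i,k}(p, κ) ≤ 1`. -/
def IsOptimal {N M K : ℕ} (c : Fin N → Fin M → ℝ) (lam : Fin M → ℝ)
    (kap : Fin N → Fin M → Fin K → ℝ) (p : Fin N → Fin M → ℝ) : Prop :=
  (p ∈ strategies N M ∧ ∀ i k, load p kap i k ≤ 1) ∧
    ∀ q ∈ strategies N M, (∀ i k, load q kap i k ≤ 1) → meanCost p c lam ≤ meanCost q c lam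

/-- Parameters of the system: `N` nodes, `M` classes, `K` resource types. One node, `rej`, is the
fictitious rejection node (infinite capacity, cost `1`); one class, `nul`, is the fictitious null
class (no arrival: no cost, no resource). -/
structure System (N M K : ℕ) where
  rej : Fin N
  nul : Fin M
  /-- arrival probabilities -/
  lam : Fin M → ℝ
  /-- mean costs -/
  c : Fin N → Fin M → ℝ
  /-- mean resource requirements -/
  a : Fin N → Fin M → Fin K → ℝ
  /-- known capacities -/
  beta : Fin N → Fin K → ℝ≥0∞
  lam_nonneg : ∀ j, 0 ≤ lam j
  lam_sum : ∑ j, lam j = 1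
  c_mem : ∀ i j, c i j ∈ Set.Icc (0 : ℝ) 1
  a_nonneg : ∀ i j k, 0 ≤ a i j k
  beta_ne_zero : ∀ i k, beta i k ≠ 0
  beta_rej : ∀ k, beta rej k = ⊤
  c_rej : ∀ j, j ≠ nul → c rej j = 1
  c_nul : ∀ i, c i nul = 0
  a_nul : ∀ i k, a i nul k = 0

/-- `κ_{i,j,k} = λ_j a_{i,j,k} / β_{i,k}` (which is `0` when `β_{i,k} = ∞`). -/
noncomputable def System.kap {N M K : ℕ} (S : System N M K) (i : Fin N) (j : Fin M)
    (k : Fin K) : ℝ :=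
  S.lam j * S.a i j k * ((S.beta i k)⁻¹).toReal

/-- The random quantities of one run; the time slots are `t = 1, 2, …`. -/
structure Run (N M K : ℕ) (Ω : Type*) where
  /-- class `j(t)` arriving in slot `t` -/
  cls : ℕ → Ω → Fin M
  /-- node `i(t)` in which it is placed -/
  node : ℕ → Ω → Fin N
  /-- costs `C_{i,j}(t)` -/
  C : ℕ → Ω → Fin N → Fin M → ℝ
  /-- resource requirements `A_{i,j,k}(t)` -/
  A : ℕ → Ω → Fin N → Fin M → Fin K → ℝ
  /-- policy `p̂(t)` used by the learner -/
  phat : ℕ → Ω → Fin N → Fin M → ℝ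

namespace Run

variable {N M K : ℕ} {Ω : Type*}

/-- `n_{i,j}(t)`: number of slots before `t` in which class `j` arrived and was placed at `i`. -/
def count (R : Run N M K Ω) (t : ℕ) (ω : Ω) (i : Fin N) (j : Fin M) : ℕ :=
  ∑ s ∈ Finset.Ico 1 t, if R.cls s ω = j ∧ R.node s ω = i then 1 else 0

/-- `n_j(t)`: number of slots before `t` in which class `j` arrived. -/
def classCount (R : Run N M K Ω) (t : ℕ) (ω : Ω) (j : Fin M) : ℕ :=
  ∑ s ∈ Finset.Ico 1 t, if R.cls s ω = j then 1 else 0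

/-- The estimate of `λ_j` (here and below, an estimate without any observation is `0`). -/
noncomputable def lamHat (R : Run N M K Ω) (t : ℕ) (ω : Ω) (j : Fin M) : ℝ :=
  (R.classCount t ω j : ℝ) / ((t : ℝ) - 1)

/-- The estimate of `c_{i,j}`. -/
noncomputable def cHat (R : Run N M K Ω) (t : ℕ) (ω : Ω) (i : Fin N) (j : Fin M) : ℝ :=
  (∑ s ∈ Finset.Ico 1 t, if R.cls s ω = j ∧ R.node s ω = i then R.C s ω i j else 0) /
    (R.count t ω i j : ℝ)

/-- The estimate of `κ_{i,j,k}`. -/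
noncomputable def kapHat (S : System N M K) (R : Run N M K Ω) (t : ℕ) (ω : Ω) (i : Fin N)
    (j : Fin M) (k : Fin K) : ℝ :=
  (∑ s ∈ Finset.Ico 1 t,
    if R.cls s ω = j then R.A s ω i j k * ((S.beta i k)⁻¹).toReal else 0) / ((t : ℝ) - 1)

/-- `λ⁻_j(t)`. -/
noncomputable def lamLow (R : Run N M K Ω) (t : ℕ) (ω : Ω) (j : Fin M) : ℝ :=
  lcb t t (R.lamHat t ω j)

/-- `c⁻_{i,j}(t)`. -/
noncomputable def cLow (R : Run N M K Ω) (t : ℕ) (ω : Ω) (i : Fin N) (j : Fin M) : ℝ :=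
  lcb (R.count t ω i j) t (R.cHat t ω i j)

open Classical in
/-- `κ⁺_{i,j,k}(t)`. Capacities are known, so at a node with infinite capacity the normalized
use is known to be `0` and the constraint is void. -/
noncomputable def kapUp (S : System N M K) (R : Run N M K Ω) (t : ℕ) (ω : Ω) (i : Fin N)
    (j : Fin M) (k : Fin K) : ℝ :=
  if S.beta i k = ⊤ then 0 else ucb t t (R.kapHat S t ω i j k)

/-- What is revealed by nature in slot `t`: the arriving class, the costs, the requirements. -/
def nature (R : Run N M K Ω) (t : ℕ) (ω : Ω) :
    Fin M × (Fin N → Fin M → ℝ) × (Fin N → Fin M → Fin K → ℝ) :=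
  (R.cls t ω, R.C t ω, R.A t ω)

/-- The event that the policy of slot `t` satisfies the true resource constraints. -/
def feasible (S : System N M K) (R : Run N M K Ω) (t : ℕ) : Set Ω :=
  {ω | ∀ i k, load (R.phat t ω) S.kap i k ≤ 1}

variable [MeasurableSpace Ω]

/-- The stochastic environment. `ℱ t` is the information generated before slot `t`. Costs and
requirements may be correlated over `i, j, k` within a slot. -/
structure IsEnvironment (S : System N M K) (R : Run N M K Ω)
    (ℱ : Filtration ℕ (inferInstance : MeasurableSpace Ω)) (P : Measure Ω) : Prop where
  measurable_nature : ∀ t, 1 ≤ t → Measurable[ℱ (t + 1)] (R.nature t)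
  measurable_node : ∀ t, 1 ≤ t → Measurable[ℱ (t + 1)] (R.node t)
  C_mem : ∀ t, 1 ≤ t → ∀ ω i j, R.C t ω i j ∈ Set.Icc (0 : ℝ) 1
  A_nonneg : ∀ t, 1 ≤ t → ∀ ω i j k, 0 ≤ R.A t ω i j k
  A_le : ∀ t, 1 ≤ t → ∀ ω i j k, ENNReal.ofReal (R.A t ω i j k) ≤ S.beta i k
  C_nul : ∀ t, 1 ≤ t → ∀ ω i, R.C t ω i S.nul = 0
  A_nul : ∀ t, 1 ≤ t → ∀ ω i k, R.A t ω i S.nul k = 0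
  /-- each slot is independent of the past -/
  indep_past : ∀ t, 1 ≤ t →
    Indep (ℱ t) (MeasurableSpace.comap (R.nature t) inferInstance) P
  /-- within a slot, the arriving class is independent of the costs and requirements -/
  indep_cls : ∀ t, 1 ≤ t → IndepFun (R.cls t) (fun ω => (R.C t ω, R.A t ω)) P
  law_cls : ∀ t, 1 ≤ t → ∀ j, P.real {ω | R.cls t ω = j} = S.lam j
  ident_C : ∀ t, 1 ≤ t → ∀ i j,
    IdentDistrib (fun ω => R.C t ω i j) (fun ω => R.C 1 ω i j) P P
  mean_C : ∀ t, 1 ≤ t → ∀ i j, ∫ ω, R.C t ω i j ∂P = S.c i j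
  ident_A : ∀ t, 1 ≤ t → ∀ i j k,
    IdentDistrib (fun ω => R.A t ω i j k) (fun ω => R.A 1 ω i j k) P P
  integrable_A : ∀ t, 1 ≤ t → ∀ i j k, Integrable (fun ω => R.A t ω i j k) P
  mean_A : ∀ t, 1 ≤ t → ∀ i j k, ∫ ω, R.A t ω i j k ∂P = S.a i j k

/-- The learner runs the base algorithm: `p̂(t)`, chosen from the information before slot `t`, is
a solution of the placement program with the confidence bounds in place of the unknown
parameters, and the arriving function is placed at a node drawn from column `j(t)` of `p̂(t)`. -/
structure FollowsBaseAlgorithm (S : System N M K) (R : Run N M K Ω)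
    (ℱ : Filtration ℕ (inferInstance : MeasurableSpace Ω)) (P : Measure Ω) : Prop where
  measurable_phat : ∀ t, 1 ≤ t → Measurable[ℱ t] (R.phat t)
  optimal : ∀ t, 1 ≤ t → ∀ ω,
    IsOptimal (R.cLow t ω) (R.lamLow t ω) (R.kapUp S t ω) (R.phat t ω)
  draw : ∀ t, 1 ≤ t → ∀ i,
    P[({ω | R.node t ω = i}.indicator fun _ => (1 : ℝ)) |
        (ℱ t : MeasurableSpace Ω) ⊔ MeasurableSpace.comap (R.nature t) inferInstance]
      =ᵐ[P] fun ω => R.phat t ω i (R.cls t ω)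

/-- The expected regret `R(T)` against the static policy `pstar`. -/
noncomputable def regret (S : System N M K) (R : Run N M K Ω) (P : Measure Ω)
    (pstar : Fin N → Fin M → ℝ) (T : ℕ) : ℝ :=
  ∑ t ∈ Finset.Icc 1 T,
    ∫ ω, (meanCost (R.phat t ω) S.c S.lam - meanCost pstar S.c S.lam) ∂P

end Run

end Placement

namespace Placement

/-- The cumulant generating function of the Bernoulli law with mean `y`. -/
noncomputable def bernCGF (y θ : ℝ) : ℝ := Real.log (1 - y + y * Real.exp θ)

lemma bernMGF_pos {y : ℝ} (hy : y ∈ Set.Icc (0 : ℝ) 1) (θ : ℝ) :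
    0 < 1 - y + y * Real.exp θ := by
  rcases hy.1.eq_or_lt with h | h
  · simp [← h]
  · have := mul_pos h (Real.exp_pos θ)
    linarith [hy.2]

/-- Hoeffding's lemma for the Bernoulli law. -/
lemma bernMGF_le_exp {y : ℝ} (hy : y ∈ Set.Icc (0 : ℝ) 1) (θ : ℝ) :
    1 - y + y * Real.exp θ ≤ Real.exp (θ * y + θ ^ 2 / 8) := by
  obtain ⟨h0, h1⟩ := hy
  have h1' : 0 ≤ 1 - y := by linarith
  set ν : Measure ℝ :=
    ENNReal.ofReal (1 - y) • Measure.dirac 0 + ENNReal.ofReal y • Measure.dirac 1 with hν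
  have hint : ∀ f : ℝ → ℝ, ∫ x, f x ∂ν = (1 - y) * f 0 + y * f 1 := by
    intro f
    rw [hν, integral_add_measure, integral_smul_measure, integral_smul_measure, integral_dirac,
      integral_dirac, ENNReal.toReal_ofReal h1', ENNReal.toReal_ofReal h0, smul_eq_mul,
      smul_eq_mul]
    · exact (integrable_dirac (by simp)).smul_measure ENNReal.ofReal_ne_top
    · exact (integrable_dirac (by simp)).smul_measure ENNReal.ofReal_ne_top
  have : IsProbabilityMeasure ν := ⟨by
    simp only [hν, Measure.add_apply, Measure.smul_apply, measure_univ, smul_eq_mul, mul_one]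
    rw [← ENNReal.ofReal_add h1' h0]; simp⟩
  have hb : ∀ᵐ x ∂ν, id x ∈ Set.Icc (0 : ℝ) 1 := by
    rw [hν, ae_add_measure_iff]
    constructor <;>
    · refine Measure.ae_smul_measure ?_ _
      rw [ae_dirac_eq]
      simp
  have h := (hasSubgaussianMGF_of_mem_Icc aemeasurable_id hb).mgf_le θ
  rw [mgf, hint, hint] at h
  simp only [id_eq, mul_zero, mul_one, zero_add, sub_zero, nnnorm_one, zero_sub] at h
  have e : ((((1 : NNReal) / 2) ^ 2 : NNReal) : ℝ) * θ ^ 2 / 2 = θ ^ 2 / 8 := by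
    push_cast; ring
  rw [e] at h
  have h2 := mul_le_mul_of_nonneg_left h (Real.exp_pos (θ * y)).le
  rw [← Real.exp_add] at h2
  refine le_trans (le_of_eq ?_) h2
  have e1 : Real.exp (θ * y) * Real.exp (θ * -y) = 1 := by
    rw [← Real.exp_add]; simp
  have e2 : Real.exp (θ * y) * Real.exp (θ * (1 - y)) = Real.exp θ := by
    rw [← Real.exp_add]; ring_nf
  linear_combination (-(1 - y)) * e1 - y * e2

lemma bernCGF_le {y : ℝ} (hy : y ∈ Set.Icc (0 : ℝ) 1) (θ : ℝ) :
    bernCGF y θ ≤ θ * y + θ ^ 2 / 8 := by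
  rw [bernCGF, Real.log_le_iff_le_exp (bernMGF_pos hy θ)]
  exact bernMGF_le_exp hy θ

lemma mul_log_div_ge {u v : ℝ} (hu : 0 ≤ u) (hv : 0 < v) : u - v ≤ u * Real.log (u / v) := by
  rcases hu.eq_or_lt with h | h
  · simp [← h, hv.le]
  · have h1 := Real.one_sub_inv_le_log_of_pos (div_pos h hv)
    have h2 := mul_le_mul_of_nonneg_left h1 hu
    have h3 : u * (1 - (u / v)⁻¹) = u - v := by field_simp
    linarith

/-- The Gibbs variational inequality for Bernoulli laws. -/
lemma tilt_le_bernKL {x y : ℝ} (hx : x ∈ Set.Icc (0 : ℝ) 1) (hy : y ∈ Set.Icc (0 : ℝ) 1) (θ : ℝ) :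
    ENNReal.ofReal (θ * x - bernCGF y θ) ≤ bernKL x y := by
  unfold bernKL
  split_ifs with h
  · exact le_top
  apply ENNReal.ofReal_le_ofReal
  push Not at h
  have hZ := bernMGF_pos hy θ
  set Z := 1 - y + y * Real.exp θ with hZdef
  have key1 : x - y * Real.exp θ / Z ≤ x * Real.log (x / y) - x * θ + x * Real.log Z := by
    rcases hx.1.eq_or_lt with h0 | h0
    · have : 0 ≤ y * Real.exp θ / Z := div_nonneg (mul_nonneg hy.1 (Real.exp_pos _).le) hZ.le
      simp [← h0, this]
    · have hy0 : 0 < y := lt_of_le_of_ne hy.1 fun e => h0.ne' (h.1 e.symm)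
      refine (mul_log_div_ge hx.1 (by positivity)).trans (le_of_eq ?_)
      rw [Real.log_div h0.ne' (by positivity), Real.log_div h0.ne' hy0.ne',
        Real.log_div (by positivity) hZ.ne', Real.log_mul hy0.ne' (Real.exp_pos _).ne',
        Real.log_exp]
      ring
  have key2 : (1 - x) - (1 - y) / Z ≤
      (1 - x) * Real.log ((1 - x) / (1 - y)) + (1 - x) * Real.log Z := by
    rcases hx.2.eq_or_lt with h0 | h0
    · have : 0 ≤ (1 - y) / Z := div_nonneg (by linarith [hy.2]) hZ.le
      simp [h0, this]
    · have hy0 : 0 < 1 - y := sub_pos.2 (lt_of_le_of_ne hy.2 fun e => h0.ne (h.2 e))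
      have h0' : 0 < 1 - x := by linarith
      refine (mul_log_div_ge h0'.le (by positivity)).trans (le_of_eq ?_)
      rw [Real.log_div h0'.ne' (by positivity), Real.log_div h0'.ne' hy0.ne',
        Real.log_div hy0.ne' hZ.ne']
      ring
  have key3 : y * Real.exp θ / Z + (1 - y) / Z = 1 := by
    rw [← add_div, div_eq_one_iff_eq hZ.ne']; ring
  have e : bernCGF y θ = Real.log Z := rfl
  rw [e]
  linarith

/-- Pinsker's inequality for Bernoulli laws. -/
lemma pinsker {x y : ℝ} (hx : x ∈ Set.Icc (0 : ℝ) 1) (hy : y ∈ Set.Icc (0 : ℝ) 1) :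
    ENNReal.ofReal (2 * (x - y) ^ 2) ≤ bernKL x y := by
  refine le_trans (ENNReal.ofReal_le_ofReal ?_) (tilt_le_bernKL hx hy (4 * (x - y)))
  have := bernCGF_le hy (4 * (x - y))
  nlinarith

lemma bernKL_self {x : ℝ} : bernKL x x = 0 := by
  have h : ∀ z : ℝ, z * Real.log (z / z) = 0 := by
    intro z
    rcases eq_or_ne z 0 with h | h
    · simp [h]
    · simp [div_self h]
  unfold bernKL
  rw [if_neg (by tauto), h, h]
  simp

lemma bernKL_one_sub (x y : ℝ) : bernKL (1 - x) (1 - y) = bernKL x y := by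
  have h : ((1 - y = 0 ∧ 1 - x ≠ 0) ∨ (1 - y = 1 ∧ 1 - x ≠ 1)) ↔
      ((y = 0 ∧ x ≠ 0) ∨ (y = 1 ∧ x ≠ 1)) := by
    rw [sub_eq_zero, sub_ne_zero, sub_eq_self, ne_eq (1 - x) 1, sub_eq_self, or_comm,
      eq_comm (a := (1 : ℝ)), ne_comm (a := (1 : ℝ))]
  unfold bernKL
  simp only [h, sub_sub_cancel]
  rw [add_comm]

/-- Above the mean, the relative entropy is the supremum of the tilts by positive parameters. -/
lemma exists_tilt_gt {x μ d : ℝ} (hx : x ≤ 1) (hμ : 0 ≤ μ) (hxμ : μ < x) (hd : 0 ≤ d)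
    (h : ENNReal.ofReal d < bernKL x μ) : ∃ θ : ℝ, 0 < θ ∧ d < θ * x - bernCGF μ θ := by
  have hx0 : 0 < x := hμ.trans_lt hxμ
  rcases hμ.eq_or_lt with h0 | h0
  · refine ⟨(d + 1) / x, by positivity, ?_⟩
    rw [div_mul_cancel₀ _ hx0.ne', ← h0]
    simp [bernCGF]
  have hμ1 : μ < 1 := hxμ.trans_le hx
  rw [bernKL, if_neg (by rintro (h | h) <;> linarith [h.1])] at h
  have hlt := (ENNReal.ofReal_lt_ofReal_iff_of_nonneg hd).1 h
  rcases hx.eq_or_lt with h1 | h1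
  · subst h1
    simp only [one_div, Real.log_inv, one_mul, sub_self, zero_mul, add_zero] at hlt
    have hμd : μ < Real.exp (-d) := by
      rw [← Real.log_lt_iff_lt_exp h0]; linarith
    have hed : Real.exp (-d) ≤ 1 := Real.exp_le_one_iff.2 (by linarith)
    set u := (Real.exp (-d) - μ) / 2 with hu
    have hu0 : 0 < u := by rw [hu]; linarith
    have hu1 : u < 1 := by rw [hu]; linarith
    refine ⟨-Real.log u, by linarith [Real.log_neg hu0 hu1], ?_⟩
    have e1 : 1 - μ + μ * Real.exp (-Real.log u) = ((1 - μ) * u + μ) / u := by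
      rw [Real.exp_neg, Real.exp_log hu0]; field_simp
    rw [bernCGF, e1, Real.log_div (by nlinarith) hu0.ne']
    have : Real.log ((1 - μ) * u + μ) < -d := by
      rw [Real.log_lt_iff_lt_exp (by nlinarith)]
      nlinarith
    linarith
  · have hx1 : 0 < 1 - x := by linarith
    have hm1 : 0 < 1 - μ := by linarith
    refine ⟨Real.log (x * (1 - μ) / (μ * (1 - x))), Real.log_pos ?_, ?_⟩
    · rw [one_lt_div (by positivity)]; nlinarith
    · have e1 : 1 - μ + μ * Real.exp (Real.log (x * (1 - μ) / (μ * (1 - x)))) =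
          (1 - μ) / (1 - x) := by
        rw [Real.exp_log (by positivity)]; field_simp; ring
      rw [bernCGF, e1, Real.log_div (by positivity) (by positivity),
        Real.log_mul hx0.ne' hm1.ne', Real.log_mul h0.ne' hx1.ne',
        Real.log_div hm1.ne' hx1.ne']
      rw [Real.log_div hx0.ne' h0.ne', Real.log_div hx1.ne' hm1.ne'] at hlt
      linarith

section Bounds

variable {w t : ℕ} {x : ℝ}

lemma mem_plausible_self (hx : x ∈ Set.Icc (0 : ℝ) 1) : x ∈ plausible w t x :=
  ⟨hx, by simp [bernKL_self]⟩

lemma bddBelow_plausible : BddBelow (plausible w t x) := ⟨0, fun _ hy => hy.1.1⟩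

lemma bddAbove_plausible : BddAbove (plausible w t x) := ⟨1, fun _ hy => hy.1.2⟩

lemma lcb_le_self (hx : x ∈ Set.Icc (0 : ℝ) 1) : lcb w t x ≤ x :=
  csInf_le bddBelow_plausible (mem_plausible_self hx)

lemma self_le_ucb (hx : x ∈ Set.Icc (0 : ℝ) 1) : x ≤ ucb w t x :=
  le_csSup bddAbove_plausible (mem_plausible_self hx)

lemma lcb_nonneg : 0 ≤ lcb w t x := Real.sInf_nonneg fun _ hy => hy.1.1

lemma abs_sub_le_of_mem_plausible (hx : x ∈ Set.Icc (0 : ℝ) 1) (hw : 1 ≤ w) (ht : 1 ≤ t) {y : ℝ}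
    (hy : y ∈ plausible w t x) : |x - y| ≤ √(Real.log t / (2 * w)) := by
  have h := (mul_le_mul_right (pinsker hx hy.1) (w : ℝ≥0∞)).trans hy.2
  have hw' : (0 : ℝ) < w := by exact_mod_cast hw
  have hl : 0 ≤ Real.log t := Real.log_nonneg (by exact_mod_cast ht)
  rw [← ENNReal.ofReal_natCast, ← ENNReal.ofReal_mul hw'.le, ENNReal.ofReal_le_ofReal_iff hl] at h
  rw [← Real.sqrt_sq_eq_abs]
  apply Real.sqrt_le_sqrt
  rw [le_div_iff₀ (by positivity)]
  linarith

lemma self_sub_le_lcb (hx : x ∈ Set.Icc (0 : ℝ) 1) (hw : 1 ≤ w) (ht : 1 ≤ t) :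
    x - √(Real.log t / (2 * w)) ≤ lcb w t x :=
  le_csInf ⟨x, mem_plausible_self hx⟩ fun y hy => by
    linarith [le_abs_self (x - y), abs_sub_le_of_mem_plausible hx hw ht hy]

lemma ucb_le_self_add (hx : x ∈ Set.Icc (0 : ℝ) 1) (hw : 1 ≤ w) (ht : 1 ≤ t) :
    ucb w t x ≤ x + √(Real.log t / (2 * w)) :=
  csSup_le ⟨x, mem_plausible_self hx⟩ fun y hy => by
    linarith [neg_abs_le (x - y), abs_sub_le_of_mem_plausible hx hw ht hy]

lemma ofReal_div_lt_bernKL {μ : ℝ} (hw : 1 ≤ w) (hμ : μ ∈ Set.Icc (0 : ℝ) 1)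
    (h : μ ∉ plausible w t x) : ENNReal.ofReal (Real.log t / w) < bernKL x μ := by
  by_contra hc
  refine h ⟨hμ, (mul_le_mul_right (not_lt.1 hc) (w : ℝ≥0∞)).trans (le_of_eq ?_)⟩
  have hw' : (0 : ℝ) < w := by exact_mod_cast hw
  rw [← ENNReal.ofReal_natCast, ← ENNReal.ofReal_mul hw'.le, mul_div_cancel₀ _ hw'.ne']

lemma bernKL_gt_of_lt_lcb {μ : ℝ} (hx : x ∈ Set.Icc (0 : ℝ) 1) (hw : 1 ≤ w)
    (hμ : μ ∈ Set.Icc (0 : ℝ) 1) (h : μ < lcb w t x) :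
    μ < x ∧ ENNReal.ofReal (Real.log t / w) < bernKL x μ :=
  ⟨h.trans_le (lcb_le_self hx), ofReal_div_lt_bernKL hw hμ fun hc =>
    absurd (csInf_le bddBelow_plausible hc) (not_le.2 h)⟩

lemma bernKL_gt_of_ucb_lt {μ : ℝ} (hx : x ∈ Set.Icc (0 : ℝ) 1) (hw : 1 ≤ w)
    (hμ : μ ∈ Set.Icc (0 : ℝ) 1) (h : ucb w t x < μ) :
    x < μ ∧ ENNReal.ofReal (Real.log t / w) < bernKL x μ :=
  ⟨(self_le_ucb hx).trans_lt h, ofReal_div_lt_bernKL hw hμ fun hc =>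
    absurd (le_csSup bddAbove_plausible hc) (not_le.2 h)⟩

end Bounds

section MeanLE

variable {Ω : Type*} [MeasurableSpace Ω] {P : Measure Ω}

/-- `X`, possibly not measurable, has an integrable majorant of mean at most `b`. -/
def MeanLE (P : Measure Ω) (X : Ω → ℝ) (b : ℝ) : Prop :=
  ∃ Y : Ω → ℝ, Integrable Y P ∧ (∀ ω, X ω ≤ Y ω) ∧ ∫ ω, Y ω ∂P ≤ b

lemma MeanLE.mono {X X' : Ω → ℝ} {b b' : ℝ} (h : MeanLE P X b) (hX : ∀ ω, X' ω ≤ X ω)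
    (hb : b ≤ b') : MeanLE P X' b' := by
  obtain ⟨Y, hY, hle, hi⟩ := h
  exact ⟨Y, hY, fun ω => (hX ω).trans (hle ω), hi.trans hb⟩

lemma MeanLE.add {X X' : Ω → ℝ} {b b' : ℝ} (h : MeanLE P X b) (h' : MeanLE P X' b') :
    MeanLE P (fun ω => X ω + X' ω) (b + b') := by
  obtain ⟨Y, hY, hle, hi⟩ := h
  obtain ⟨Y', hY', hle', hi'⟩ := h'
  exact ⟨fun ω => Y ω + Y' ω, hY.add hY', fun ω => add_le_add (hle ω) (hle' ω), by
    rw [integral_add hY hY']; exact add_le_add hi hi'⟩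

lemma MeanLE.const_mul {X : Ω → ℝ} {b : ℝ} (h : MeanLE P X b) {a : ℝ} (ha : 0 ≤ a) :
    MeanLE P (fun ω => a * X ω) (a * b) := by
  obtain ⟨Y, hY, hle, hi⟩ := h
  exact ⟨fun ω => a * Y ω, hY.const_mul a, fun ω => mul_le_mul_of_nonneg_left (hle ω) ha, by
    rw [integral_const_mul]; exact mul_le_mul_of_nonneg_left hi ha⟩

lemma MeanLE.sum {ι : Type*} (s : Finset ι) {X : ι → Ω → ℝ} {b : ι → ℝ}
    (h : ∀ i ∈ s, MeanLE P (X i) (b i)) :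
    MeanLE P (fun ω => ∑ i ∈ s, X i ω) (∑ i ∈ s, b i) := by
  classical
  induction s using Finset.induction_on with
  | empty => exact ⟨fun _ => 0, integrable_zero _ _ _, by simp, by simp⟩
  | insert i s hi ih =>
    simp only [Finset.sum_insert hi]
    exact (h i (by simp)).add (ih fun j hj => h j (by simp [hj]))

lemma MeanLE.const [IsProbabilityMeasure P] (b : ℝ) : MeanLE P (fun _ => b) b :=
  ⟨fun _ => b, integrable_const b, fun _ => le_rfl, by simp⟩

lemma MeanLE.of_integrable {X : Ω → ℝ} (h : Integrable X P) : MeanLE P X (∫ ω, X ω ∂P) :=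
  ⟨X, h, fun _ => le_rfl, le_rfl⟩

lemma MeanLE.indicator [IsProbabilityMeasure P] {E : Set Ω} {b : ℝ} (hb : P.real E ≤ b) :
    MeanLE P (E.indicator fun _ => 1) b := by
  refine ⟨(toMeasurable P E).indicator fun _ => 1,
    (integrable_const 1).indicator (measurableSet_toMeasurable P E), fun ω => ?_, ?_⟩
  · exact Set.indicator_le_indicator_of_subset (subset_toMeasurable P E) (fun _ => zero_le_one) ω
  · rw [integral_indicator_const _ (measurableSet_toMeasurable P E)]
    simpa [measureReal_def, measure_toMeasurable] using hb

lemma MeanLE.integral_le {X : Ω → ℝ} {b : ℝ} (h : MeanLE P X b) (hX : Integrable X P) :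
    ∫ ω, X ω ∂P ≤ b := by
  obtain ⟨Y, hY, hle, hi⟩ := h
  exact (integral_mono hX hY hle).trans hi

end MeanLE

section AdaptiveSample

variable {Ω : Type*} {mΩ : MeasurableSpace Ω}

/-- Observations `Z t ∈ [0, 1]`, made in the slots with `B t = 1`, that have mean `μ` conditionally
on the past and on being made. -/
structure AdaptiveSample (P : Measure Ω) (ℱ : Filtration ℕ mΩ) (B : ℕ → Ω → ℕ) (Z : ℕ → Ω → ℝ)
    (μ : ℝ) : Prop where
  measurable_B : ∀ t, 1 ≤ t → Measurable[ℱ (t + 1)] (B t)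
  measurable_Z : ∀ t, 1 ≤ t → Measurable[ℱ (t + 1)] (Z t)
  B_le : ∀ t, 1 ≤ t → ∀ ω, B t ω ≤ 1
  Z_mem : ∀ t, 1 ≤ t → ∀ ω, Z t ω ∈ Set.Icc (0 : ℝ) 1
  mean_mem : μ ∈ Set.Icc (0 : ℝ) 1
  unbiased : ∀ t, 1 ≤ t → ∀ U : Ω → ℝ, Measurable[ℱ t] U → (∃ b, ∀ ω, |U ω| ≤ b) →
    ∫ ω, U ω * (B t ω * (Z t ω - μ)) ∂P = 0

/-- Number of observations before slot `t`. -/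
def obsCount (B : ℕ → Ω → ℕ) (t : ℕ) (ω : Ω) : ℕ := ∑ s ∈ Finset.Ico 1 t, B s ω

/-- Sum of the observations before slot `t`. -/
def obsSum (B : ℕ → Ω → ℕ) (Z : ℕ → Ω → ℝ) (t : ℕ) (ω : Ω) : ℝ :=
  ∑ s ∈ Finset.Ico 1 t, (B s ω : ℝ) * Z s ω

/-- Empirical mean of the observations before slot `t`. -/
noncomputable def obsMean (B : ℕ → Ω → ℕ) (Z : ℕ → Ω → ℝ) (t : ℕ) (ω : Ω) : ℝ :=
  obsSum B Z t ω / obsCount B t ω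

lemma integrable_of_abs_le {P : Measure Ω} [IsFiniteMeasure P] {f : Ω → ℝ} (hf : Measurable f)
    {b : ℝ} (hb : ∀ ω, |f ω| ≤ b) : Integrable f P :=
  Integrable.of_bound hf.aestronglyMeasurable b (Filter.Eventually.of_forall hb)

lemma exp_mul_le_bernMGF {z : ℝ} (hz : z ∈ Set.Icc (0 : ℝ) 1) (θ : ℝ) :
    Real.exp (θ * z) ≤ 1 - z + z * Real.exp θ := by
  have h := convexOn_exp.2 (Set.mem_univ (0 : ℝ)) (Set.mem_univ θ) (sub_nonneg.2 hz.2) hz.1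
    (by ring)
  simpa [mul_comm] using h

namespace AdaptiveSample

variable {P : Measure Ω} {ℱ : Filtration ℕ mΩ} {B : ℕ → Ω → ℕ} {Z : ℕ → Ω → ℝ} {μ : ℝ}

lemma measurable_obsCount (h : AdaptiveSample P ℱ B Z μ) (t : ℕ) :
    Measurable[ℱ t] (obsCount B t) := by
  refine Finset.measurable_fun_sum _ fun s hs => ?_
  rw [Finset.mem_Ico] at hs
  exact (h.measurable_B s hs.1).mono (ℱ.mono hs.2) le_rfl

lemma measurable_obsSum (h : AdaptiveSample P ℱ B Z μ) (t : ℕ) :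
    Measurable[ℱ t] (obsSum B Z t) := by
  refine Finset.measurable_fun_sum _ fun s hs => ?_
  rw [Finset.mem_Ico] at hs
  exact ((measurable_from_top.comp (h.measurable_B s hs.1)).mul (h.measurable_Z s hs.1)).mono
    (ℱ.mono hs.2) le_rfl

lemma measurable_obsMean (h : AdaptiveSample P ℱ B Z μ) (t : ℕ) :
    Measurable[ℱ t] (obsMean B Z t) :=
  (h.measurable_obsSum t).div (measurable_from_top.comp (h.measurable_obsCount t))

lemma obsCount_le (h : AdaptiveSample P ℱ B Z μ) (t : ℕ) (ω : Ω) : obsCount B t ω ≤ t - 1 := by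
  refine (Finset.sum_le_card_nsmul _ _ 1 fun s hs => ?_).trans (by simp)
  exact h.B_le s (Finset.mem_Ico.1 hs).1 ω

lemma obsSum_mem (h : AdaptiveSample P ℱ B Z μ) (t : ℕ) (ω : Ω) :
    obsSum B Z t ω ∈ Set.Icc (0 : ℝ) (obsCount B t ω) := by
  have hz := fun s (hs : s ∈ Finset.Ico 1 t) => h.Z_mem s (Finset.mem_Ico.1 hs).1 ω
  constructor
  · exact Finset.sum_nonneg fun s hs => mul_nonneg (Nat.cast_nonneg _) (hz s hs).1
  · rw [obsCount, Nat.cast_sum]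
    exact Finset.sum_le_sum fun s hs => mul_le_of_le_one_right (Nat.cast_nonneg _) (hz s hs).2

lemma obsMean_mem (h : AdaptiveSample P ℱ B Z μ) (t : ℕ) (ω : Ω) :
    obsMean B Z t ω ∈ Set.Icc (0 : ℝ) 1 :=
  ⟨div_nonneg (h.obsSum_mem t ω).1 (Nat.cast_nonneg _),
    div_le_one_of_le₀ (h.obsSum_mem t ω).2 (Nat.cast_nonneg _)⟩

lemma obsCount_mul_obsMean (h : AdaptiveSample P ℱ B Z μ) (t : ℕ) (ω : Ω) :
    obsCount B t ω * obsMean B Z t ω = obsSum B Z t ω := by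
  rcases eq_or_ne (obsCount B t ω : ℝ) 0 with h0 | h0
  · have := h.obsSum_mem t ω
    rw [h0] at this ⊢
    linarith [this.1, this.2]
  · exact mul_div_cancel₀ _ h0

lemma obsCount_succ {t : ℕ} (ht : 1 ≤ t) (ω : Ω) :
    obsCount B (t + 1) ω = obsCount B t ω + B t ω := Finset.sum_Ico_succ_top ht _

lemma obsSum_succ {t : ℕ} (ht : 1 ≤ t) (ω : Ω) :
    obsSum B Z (t + 1) ω = obsSum B Z t ω + B t ω * Z t ω := Finset.sum_Ico_succ_top ht _

/-- The complementary observations `1 - Z`. -/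
lemma compl (h : AdaptiveSample P ℱ B Z μ) :
    AdaptiveSample P ℱ B (fun t ω => 1 - Z t ω) (1 - μ) where
  measurable_B := h.measurable_B
  measurable_Z t ht := (h.measurable_Z t ht).const_sub 1
  B_le := h.B_le
  Z_mem t ht ω := ⟨sub_nonneg.2 (h.Z_mem t ht ω).2, sub_le_self _ (h.Z_mem t ht ω).1⟩
  mean_mem := ⟨sub_nonneg.2 h.mean_mem.2, sub_le_self _ h.mean_mem.1⟩
  unbiased t ht U hU hb := by
    rw [← neg_eq_zero, ← integral_neg, ← h.unbiased t ht U hU hb]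
    congr 1; ext ω; ring

lemma obsMean_compl {t : ℕ} {ω : Ω} (h : obsCount B t ω ≠ 0) :
    obsMean B (fun t ω => 1 - Z t ω) t ω = 1 - obsMean B Z t ω := by
  have h' : (obsCount B t ω : ℝ) ≠ 0 := by exact_mod_cast h
  unfold obsMean
  rw [eq_sub_iff_add_eq, ← add_div, div_eq_one_iff_eq h', obsSum, obsSum, obsCount, Nat.cast_sum,
    ← Finset.sum_add_distrib]
  exact Finset.sum_congr rfl fun s _ => by ring

/-- The exponential process of the observations. -/
noncomputable def expProc (B : ℕ → Ω → ℕ) (Z : ℕ → Ω → ℝ) (μ θ : ℝ) (t : ℕ) (ω : Ω) : ℝ :=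
  Real.exp (θ * obsSum B Z t ω - obsCount B t ω * bernCGF μ θ)

lemma measurable_expProc (h : AdaptiveSample P ℱ B Z μ) (θ : ℝ) (t : ℕ) :
    Measurable[ℱ t] (expProc B Z μ θ t) :=
  Real.measurable_exp.comp (((h.measurable_obsSum t).const_mul θ).sub
    ((measurable_from_top.comp (h.measurable_obsCount t)).mul_const _))

lemma abs_expProc_le (h : AdaptiveSample P ℱ B Z μ) (θ : ℝ) (t : ℕ) (ω : Ω) :
    |expProc B Z μ θ t ω| ≤ Real.exp (t * (|θ| + |bernCGF μ θ|)) := by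
  rw [expProc, Real.abs_exp]
  apply Real.exp_le_exp.2
  have hc : (obsCount B t ω : ℝ) ≤ t := by
    exact_mod_cast (h.obsCount_le t ω).trans (Nat.sub_le _ _)
  have hs := h.obsSum_mem t ω
  have h1 : θ * obsSum B Z t ω ≤ |θ| * t :=
    mul_le_mul (le_abs_self θ) (hs.2.trans hc) hs.1 (abs_nonneg θ)
  have h2 : obsCount B t ω * -bernCGF μ θ ≤ t * |bernCGF μ θ| :=
    (mul_le_mul_of_nonneg_left (neg_le_abs _) (Nat.cast_nonneg _)).trans
      (mul_le_mul_of_nonneg_right hc (abs_nonneg _))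
  linarith

lemma integrable_expProc [IsProbabilityMeasure P] (h : AdaptiveSample P ℱ B Z μ) (θ : ℝ) (t : ℕ) :
    Integrable (expProc B Z μ θ t) P :=
  integrable_of_abs_le ((h.measurable_expProc θ t).mono (ℱ.le t) le_rfl) (h.abs_expProc_le θ t)

lemma expProc_succ_le (h : AdaptiveSample P ℱ B Z μ) (θ : ℝ) {t : ℕ} (ht : 1 ≤ t) (ω : Ω) :
    expProc B Z μ θ (t + 1) ω ≤ expProc B Z μ θ t ω +
      (Real.exp θ - 1) / Real.exp (bernCGF μ θ) *
        (expProc B Z μ θ t ω * (B t ω * (Z t ω - μ))) := by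
  have hB : B t ω = 0 ∨ B t ω = 1 := by have := h.B_le t ht ω; omega
  have e : expProc B Z μ θ (t + 1) ω =
      expProc B Z μ θ t ω * Real.exp (B t ω * (θ * Z t ω - bernCGF μ θ)) := by
    rw [expProc, expProc, ← Real.exp_add, obsCount_succ ht, obsSum_succ ht]
    push_cast
    ring_nf
  have hpos : 0 < expProc B Z μ θ t ω := Real.exp_pos _
  rcases hB with h0 | h0
  · rw [e]; simp [h0]
  · have hM := bernMGF_pos h.mean_mem θ
    have hM' : Real.exp (bernCGF μ θ) = 1 - μ + μ * Real.exp θ := Real.exp_log hM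
    have h1 : Real.exp (θ * Z t ω - bernCGF μ θ) ≤
        1 + (Real.exp θ - 1) / Real.exp (bernCGF μ θ) * (Z t ω - μ) := by
      rw [Real.exp_sub, hM', div_le_iff₀ hM]
      have := exp_mul_le_bernMGF (h.Z_mem t ht ω) θ
      have e2 : (1 + (Real.exp θ - 1) / (1 - μ + μ * Real.exp θ) * (Z t ω - μ)) *
          (1 - μ + μ * Real.exp θ) = 1 - Z t ω + Z t ω * Real.exp θ := by
        rw [add_mul, mul_right_comm, div_mul_cancel₀ _ hM.ne']; ring
      rw [e2]; exact this
    have h2 := mul_le_mul_of_nonneg_left h1 hpos.le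
    rw [e, h0]
    simp only [Nat.cast_one, one_mul]
    linarith

lemma integrable_mul_innov [IsProbabilityMeasure P] (h : AdaptiveSample P ℱ B Z μ) {t : ℕ}
    (ht : 1 ≤ t) {U : Ω → ℝ} (hU : Measurable[ℱ t] U) {b : ℝ} (hb : ∀ ω, |U ω| ≤ b) :
    Integrable (fun ω => U ω * (B t ω * (Z t ω - μ))) P := by
  have hB : Measurable fun ω => (B t ω : ℝ) :=
    measurable_from_top.comp ((h.measurable_B t ht).mono (ℱ.le _) le_rfl)
  have hZ : Measurable (Z t) := (h.measurable_Z t ht).mono (ℱ.le _) le_rfl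
  refine integrable_of_abs_le (b := b * 1)
    ((hU.mono (ℱ.le t) le_rfl).mul (hB.mul (hZ.sub_const μ))) fun ω => ?_
  rw [abs_mul]
  refine mul_le_mul (hb ω) ?_ (abs_nonneg _) ((abs_nonneg _).trans (hb ω))
  have h1 : (B t ω : ℝ) ≤ 1 := by exact_mod_cast h.B_le t ht ω
  have hz := h.Z_mem t ht ω
  have hm := h.mean_mem
  rw [abs_mul, abs_of_nonneg (Nat.cast_nonneg _)]
  refine mul_le_one₀ h1 (abs_nonneg _) (abs_le.2 ⟨?_, ?_⟩) <;> linarith [hz.1, hz.2, hm.1, hm.2]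

lemma integral_expProc_le [IsProbabilityMeasure P] (h : AdaptiveSample P ℱ B Z μ) (θ : ℝ) {t : ℕ}
    (ht : 1 ≤ t) : ∫ ω, expProc B Z μ θ t ω ∂P ≤ 1 := by
  induction t, ht using Nat.le_induction with
  | base => simp [expProc, obsSum, obsCount]
  | succ t ht ih =>
    have hi := h.integrable_mul_innov ht (h.measurable_expProc θ t) (h.abs_expProc_le θ t)
    refine (integral_mono (h.integrable_expProc θ (t + 1))
      ((h.integrable_expProc θ t).add (hi.const_mul _)) (h.expProc_succ_le θ ht)).trans ?_
    simp only [Pi.add_apply]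
    rw [integral_add (h.integrable_expProc θ t) (hi.const_mul _), integral_const_mul,
      h.unbiased t ht _ (h.measurable_expProc θ t) ⟨_, h.abs_expProc_le θ t⟩]
    simpa using ih

lemma measureReal_tilt_le [IsProbabilityMeasure P] (h : AdaptiveSample P ℱ B Z μ) {t : ℕ}
    (ht : 1 ≤ t) (n : ℕ) (θ d : ℝ) :
    P.real {ω | obsCount B t ω = n ∧ d ≤ θ * obsMean B Z t ω - bernCGF μ θ} ≤
      Real.exp (-(n * d)) := by
  have h1 := mul_meas_ge_le_integral_of_nonneg (μ := P)
    (Filter.Eventually.of_forall fun ω => (Real.exp_pos _).le) (h.integrable_expProc θ t)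
    (Real.exp (n * d))
  have h2 : P.real {ω | obsCount B t ω = n ∧ d ≤ θ * obsMean B Z t ω - bernCGF μ θ} ≤
      P.real {ω | Real.exp (n * d) ≤ expProc B Z μ θ t ω} := by
    refine measureReal_mono ?_
    rintro ω ⟨hn, hd⟩
    refine Real.exp_le_exp.2 ?_
    rw [← h.obsCount_mul_obsMean, hn]
    nlinarith [(Nat.cast_nonneg n : (0 : ℝ) ≤ n)]
  rw [Real.exp_neg, ← one_div, le_div_iff₀' (Real.exp_pos _)]
  exact (mul_le_mul_of_nonneg_left h2 (Real.exp_pos _).le).trans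
    (h1.trans (h.integral_expProc_le θ ht))

/-- Chernoff's inequality in relative entropy form, for adaptively collected observations. -/
lemma measureReal_bernKL_le [IsProbabilityMeasure P] (h : AdaptiveSample P ℱ B Z μ) {t : ℕ}
    (ht : 1 ≤ t) (n : ℕ) {d : ℝ} (hd : 0 ≤ d) :
    P.real {ω | obsCount B t ω = n ∧ μ < obsMean B Z t ω ∧
      ENNReal.ofReal d < bernKL (obsMean B Z t ω) μ} ≤ Real.exp (-(n * d)) := by
  set A : {q : ℚ // 0 < q} → Set Ω := fun q =>
    {ω | obsCount B t ω = n ∧ d ≤ (q : ℝ) * obsMean B Z t ω - bernCGF μ q} with hA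
  have hsub : {ω | obsCount B t ω = n ∧ μ < obsMean B Z t ω ∧
      ENNReal.ofReal d < bernKL (obsMean B Z t ω) μ} ⊆ ⋃ q, A q := by
    rintro ω ⟨hn, hlt, hkl⟩
    obtain ⟨θ, hθ, hdθ⟩ := exists_tilt_gt (h.obsMean_mem t ω).2 h.mean_mem.1 hlt hd hkl
    have hcont : Continuous fun θ : ℝ => θ * obsMean B Z t ω - bernCGF μ θ := by
      refine (continuous_id.mul continuous_const).sub (Continuous.log (by fun_prop) fun θ => ?_)
      exact (bernMGF_pos h.mean_mem θ).ne'
    have hopen : IsOpen {θ : ℝ | 0 < θ ∧ d < θ * obsMean B Z t ω - bernCGF μ θ} :=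
      (isOpen_lt continuous_const continuous_id).inter (isOpen_lt continuous_const hcont)
    obtain ⟨q, hq0, hq⟩ := Rat.denseRange_cast.exists_mem_open hopen ⟨θ, hθ, hdθ⟩
    exact Set.mem_iUnion.2 ⟨⟨q, by exact_mod_cast hq0⟩, hn, hq.le⟩
  have hchain : ∀ q q' : {q : ℚ // 0 < q},
      (d + bernCGF μ q') / q' ≤ (d + bernCGF μ q) / q → A q ⊆ A q' := by
    rintro q q' hle ω ⟨hn, hd'⟩
    have hq : (0 : ℝ) < q := by exact_mod_cast q.2
    have hq' : (0 : ℝ) < q' := by exact_mod_cast q'.2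
    have h1 : (d + bernCGF μ q) / q ≤ obsMean B Z t ω := by rw [div_le_iff₀ hq]; linarith
    have h2 := (div_le_iff₀ hq').1 (hle.trans h1)
    exact ⟨hn, by linarith⟩
  have hdir : Directed (· ⊆ ·) A := by
    intro q q'
    rcases le_total ((d + bernCGF μ q') / q') ((d + bernCGF μ q) / q) with hle | hle
    · exact ⟨q', hchain q q' hle, subset_rfl⟩
    · exact ⟨q, subset_rfl, hchain q' q hle⟩
  have hU : P (⋃ q, A q) ≤ ENNReal.ofReal (Real.exp (-(n * d))) := by
    rw [hdir.measure_iUnion]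
    refine iSup_le fun q => ?_
    rw [ENNReal.le_ofReal_iff_toReal_le (measure_ne_top _ _) (Real.exp_pos _).le]
    exact h.measureReal_tilt_le ht n q d
  exact ENNReal.toReal_le_of_le_ofReal (Real.exp_pos _).le ((measure_mono hsub).trans hU)

/-- Hoeffding's inequality for adaptively collected observations. -/
lemma measureReal_dev_le [IsProbabilityMeasure P] (h : AdaptiveSample P ℱ B Z μ) {t : ℕ}
    (ht : 1 ≤ t) (n : ℕ) {r : ℝ} (hr : 0 ≤ r) :
    P.real {ω | obsCount B t ω = n ∧ μ + r < obsMean B Z t ω} ≤ Real.exp (-(n * (2 * r ^ 2))) := by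
  refine le_trans (measureReal_mono ?_) (h.measureReal_tilt_le ht n (4 * r) (2 * r ^ 2))
  rintro ω ⟨hn, hlt⟩
  refine ⟨hn, ?_⟩
  have := bernCGF_le h.mean_mem (4 * r)
  nlinarith [mul_le_mul_of_nonneg_left hlt.le hr]

lemma meanLE_dev [IsProbabilityMeasure P] (h : AdaptiveSample P ℱ B Z μ) {t : ℕ}
    (ht : 1 ≤ t) {n : ℕ} (hn : 1 ≤ n) {r : ℝ} (hr : 0 < r) :
    MeanLE P ({ω | obsCount B t ω = n}.indicator fun ω => max (obsMean B Z t ω - μ - r) 0)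
      (Real.exp (-(n * (2 * r ^ 2))) / (4 * n * r)) := by
  have hn' : (0 : ℝ) < n := by exact_mod_cast hn
  have hk : 0 ≤ Real.exp (-(n * (2 * r ^ 2))) / (4 * n * r) := by positivity
  refine ((MeanLE.of_integrable (h.integrable_expProc (4 * r) t)).const_mul hk).mono ?_
    (mul_le_of_le_one_right hk (h.integral_expProc_le (4 * r) ht))
  intro ω
  have hpos : 0 < expProc B Z μ (4 * r) t ω := Real.exp_pos _
  by_cases hω : obsCount B t ω = n
  · rw [Set.indicator_of_mem (by exact hω)]
    refine max_le ?_ (mul_nonneg hk hpos.le)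
    rw [div_mul_eq_mul_div, le_div_iff₀ (by positivity), expProc, ← Real.exp_add]
    have h1 := Real.add_one_le_exp ((obsMean B Z t ω - μ - r) * (4 * n * r))
    refine (by linarith : (obsMean B Z t ω - μ - r) * (4 * n * r) ≤ _).trans
      (Real.exp_le_exp.2 ?_)
    rw [← h.obsCount_mul_obsMean, hω]
    nlinarith [mul_le_mul_of_nonneg_left (bernCGF_le h.mean_mem (4 * r)) hn'.le]
  · rw [Set.indicator_of_notMem (by exact hω)]
    exact mul_nonneg hk hpos.le

end AdaptiveSample

end AdaptiveSample

lemma sum_range_succ_inv_sqrt_le (n : ℕ) :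
    ∑ k ∈ Finset.range (n + 1), (√(k : ℝ))⁻¹ ≤ 2 * √(n : ℝ) := by
  induction n with
  | zero => simp
  | succ n ih =>
    rw [Finset.sum_range_succ]
    refine (add_le_add_left ih _).trans ?_
    push_cast
    have hn : (0 : ℝ) ≤ n := Nat.cast_nonneg n
    have h0 : 0 < √((n : ℝ) + 1) := Real.sqrt_pos.2 (by linarith)
    have h2 : √(n : ℝ) ^ 2 = n := Real.sq_sqrt hn
    have h3 : √((n : ℝ) + 1) ^ 2 = n + 1 := Real.sq_sqrt (by linarith)
    rw [← sub_nonneg]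
    have e : 2 * √((n : ℝ) + 1) - (2 * √(n : ℝ) + (√((n : ℝ) + 1))⁻¹) =
        (√((n : ℝ) + 1) - √(n : ℝ)) ^ 2 / √((n : ℝ) + 1) := by
      field_simp
      nlinarith
    rw [e]
    positivity

lemma sum_range_inv_sqrt_le (n : ℕ) : ∑ k ∈ Finset.range n, (√(k : ℝ))⁻¹ ≤ 2 * √(n : ℝ) :=
  (Finset.sum_le_sum_of_subset_of_nonneg (Finset.range_mono n.le_succ)
    fun _ _ _ => by positivity).trans (sum_range_succ_inv_sqrt_le n)

lemma sum_range_inv_succ_le {n T : ℕ} (hn : n ≤ T) :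
    ∑ k ∈ Finset.range n, ((k : ℝ) + 1)⁻¹ ≤ 1 + Real.log T := by
  have h := harmonic_le_one_add_log T
  rw [harmonic] at h
  push_cast at h
  exact (Finset.sum_le_sum_of_subset_of_nonneg (Finset.range_mono hn)
    fun _ _ _ => by positivity).trans h

namespace AdaptiveSample

variable {Ω : Type*} {mΩ : MeasurableSpace Ω} {P : Measure Ω} {ℱ : Filtration ℕ mΩ}
  {B : ℕ → Ω → ℕ} {Z : ℕ → Ω → ℝ} {μ : ℝ}

lemma sum_obsCount_eq (h : AdaptiveSample P ℱ B Z μ) (φ : ℕ → ℝ) {T : ℕ} (hT : 1 ≤ T) (ω : Ω) :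
    ∑ t ∈ Finset.Ico 1 T, (B t ω : ℝ) * φ (obsCount B t ω) =
      ∑ k ∈ Finset.range (obsCount B T ω), φ k := by
  induction T, hT using Nat.le_induction with
  | base => simp [obsCount]
  | succ t ht ih =>
    rw [Finset.sum_Ico_succ_top ht, ih, obsCount_succ ht]
    have hB : B t ω = 0 ∨ B t ω = 1 := by have := h.B_le t ht ω; omega
    rcases hB with h0 | h0 <;> simp [h0, Finset.sum_range_succ]

/-- The centred sum of the observations before slot `t`. -/
def obsDev (B : ℕ → Ω → ℕ) (Z : ℕ → Ω → ℝ) (μ : ℝ) (t : ℕ) (ω : Ω) : ℝ :=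
  obsSum B Z t ω - obsCount B t ω * μ

/-- The accumulated normalized squared deviation at the observation times. -/
noncomputable def sqDev (B : ℕ → Ω → ℕ) (Z : ℕ → Ω → ℝ) (μ : ℝ) (T : ℕ) (ω : Ω) : ℝ :=
  ∑ t ∈ Finset.Ico 1 T,
    (B t ω : ℝ) * (obsDev B Z μ t ω ^ 2 / (obsCount B t ω * (obsCount B t ω + 1)))

lemma measurable_obsDev (h : AdaptiveSample P ℱ B Z μ) (t : ℕ) :
    Measurable[ℱ t] (obsDev B Z μ t) :=
  (h.measurable_obsSum t).sub ((measurable_from_top.comp (h.measurable_obsCount t)).mul_const μ)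

lemma abs_obsDev_le (h : AdaptiveSample P ℱ B Z μ) (t : ℕ) (ω : Ω) :
    |obsDev B Z μ t ω| ≤ obsCount B t ω := by
  have h1 := h.obsSum_mem t ω
  have h2 : (0 : ℝ) ≤ obsCount B t ω := Nat.cast_nonneg _
  have h3 := mul_nonneg h2 h.mean_mem.1
  have h4 := mul_le_of_le_one_right h2 h.mean_mem.2
  rw [obsDev, abs_le]
  constructor <;> linarith [h1.1, h1.2]

lemma obsDev_sq_step (h : AdaptiveSample P ℱ B Z μ) {t : ℕ} (ht : 1 ≤ t) (ω : Ω) :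
    obsDev B Z μ (t + 1) ω ^ 2 / obsCount B (t + 1) ω +
        (B t ω : ℝ) * (obsDev B Z μ t ω ^ 2 / (obsCount B t ω * (obsCount B t ω + 1))) ≤
      obsDev B Z μ t ω ^ 2 / obsCount B t ω +
        (2 * obsDev B Z μ t ω + 1 - 2 * μ) / (obsCount B t ω + 1) * (B t ω * (Z t ω - μ)) +
        (B t ω : ℝ) * (1 / 4 * ((obsCount B t ω : ℝ) + 1)⁻¹) := by
  have hB : B t ω = 0 ∨ B t ω = 1 := by have := h.B_le t ht ω; omega
  have hD : obsDev B Z μ (t + 1) ω = obsDev B Z μ t ω + B t ω * (Z t ω - μ) := by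
    simp only [obsDev, obsCount_succ ht, obsSum_succ ht]; push_cast; ring
  have hn0 : (0 : ℝ) ≤ obsCount B t ω := Nat.cast_nonneg _
  have hdev := h.abs_obsDev_le t ω
  rw [hD, obsCount_succ ht]
  rcases hB with h0 | h0
  · simp [h0]
  have hz := h.Z_mem t ht ω
  rw [h0]
  push_cast
  generalize (obsCount B t ω : ℝ) = n at *
  generalize obsDev B Z μ t ω = D at *
  generalize Z t ω = z at *
  have hsq : D ^ 2 / n - D ^ 2 / (n * (n + 1)) = D ^ 2 / (n + 1) := by
    rcases hn0.eq_or_lt with hn | hn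
    · have : D = 0 := by simpa [← hn] using hdev
      simp [this]
    · field_simp; ring
  have hz2 : (z - μ) ^ 2 ≤ (1 - 2 * μ) * (z - μ) + 1 / 4 := by
    nlinarith [mul_nonneg hz.1 (sub_nonneg.2 hz.2), sq_nonneg (μ - 1 / 2)]
  have hnum : (D + (z - μ)) ^ 2 / (n + 1) ≤
      (D ^ 2 + (2 * D + 1 - 2 * μ) * (z - μ) + 1 / 4) / (n + 1) :=
    div_le_div_of_nonneg_right (by linarith) (by linarith)
  have e : (D ^ 2 + (2 * D + 1 - 2 * μ) * (z - μ) + 1 / 4) / (n + 1) =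
      D ^ 2 / (n + 1) + (2 * D + 1 - 2 * μ) / (n + 1) * (z - μ) + 1 / 4 * (n + 1)⁻¹ := by
    rw [div_eq_mul_inv, div_eq_mul_inv, div_eq_mul_inv]; ring
  simp only [one_mul]
  linarith

lemma meanLE_sqDev [IsProbabilityMeasure P] (h : AdaptiveSample P ℱ B Z μ) {T : ℕ} (hT : 1 ≤ T) :
    MeanLE P (sqDev B Z μ (T + 1)) ((1 + Real.log T) / 4) := by
  set U : ℕ → Ω → ℝ := fun t ω =>
    (2 * obsDev B Z μ t ω + 1 - 2 * μ) / (obsCount B t ω + 1) with hU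
  have hUm : ∀ t, Measurable[ℱ t] (U t) := fun t =>
    ((((h.measurable_obsDev t).const_mul 2).add_const 1).sub_const _).div
      ((measurable_from_top.comp (h.measurable_obsCount t)).add_const 1)
  have hUb : ∀ t ω, |U t ω| ≤ 2 := by
    intro t ω
    have hn0 : (0 : ℝ) ≤ obsCount B t ω := Nat.cast_nonneg _
    have hd := abs_le.1 (h.abs_obsDev_le t ω)
    have hm := h.mean_mem
    rw [hU, abs_div, abs_of_pos (by linarith : (0 : ℝ) < obsCount B t ω + 1),
      div_le_iff₀ (by linarith), abs_le]
    constructor <;> linarith [hd.1, hd.2, hm.1, hm.2]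
  have hpath : ∀ (S : ℕ), 1 ≤ S → ∀ ω, obsDev B Z μ S ω ^ 2 / obsCount B S ω + sqDev B Z μ S ω ≤
      ∑ t ∈ Finset.Ico 1 S, U t ω * (B t ω * (Z t ω - μ)) +
      ∑ t ∈ Finset.Ico 1 S, (B t ω : ℝ) * (1 / 4 * ((obsCount B t ω : ℝ) + 1)⁻¹) := by
    intro S hS ω
    induction S, hS using Nat.le_induction with
    | base => simp [obsDev, obsSum, obsCount, sqDev]
    | succ t ht ih =>
      have := h.obsDev_sq_step ht ω
      rw [sqDev, Finset.sum_Ico_succ_top ht, Finset.sum_Ico_succ_top ht,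
        Finset.sum_Ico_succ_top ht]
      rw [sqDev] at ih
      linarith
  have hint : ∀ t ∈ Finset.Ico 1 (T + 1),
      Integrable (fun ω => U t ω * (B t ω * (Z t ω - μ))) P := fun t ht =>
    h.integrable_mul_innov (Finset.mem_Ico.1 ht).1 (hUm t) (hUb t)
  have h1 : MeanLE P (fun ω => ∑ t ∈ Finset.Ico 1 (T + 1), U t ω * (B t ω * (Z t ω - μ))) 0 := by
    refine (MeanLE.of_integrable (integrable_finsetSum _ hint)).mono (fun _ => le_rfl) ?_
    rw [integral_finsetSum _ hint]
    exact (Finset.sum_eq_zero fun t ht =>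
      h.unbiased t (Finset.mem_Ico.1 ht).1 _ (hUm t) ⟨2, hUb t⟩).le
  refine (h1.add (MeanLE.const ((1 + Real.log T) / 4))).mono (fun ω => ?_) (by simp)
  have h2 := hpath (T + 1) (by omega) ω
  have h3 : 0 ≤ obsDev B Z μ (T + 1) ω ^ 2 / obsCount B (T + 1) ω := by positivity
  rw [h.sum_obsCount_eq (fun n => 1 / 4 * ((n : ℝ) + 1)⁻¹) (by omega), ← Finset.mul_sum] at h2
  have h4 := sum_range_inv_succ_le (h.obsCount_le (T + 1) ω)
  rw [Nat.add_sub_cancel] at h4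
  linarith

/-- Bound for the distance of the confidence bound from the mean, at the horizon `T`. -/
noncomputable def width (B : ℕ → Ω → ℕ) (Z : ℕ → Ω → ℝ) (μ L : ℝ) (t : ℕ) (ω : Ω) : ℝ :=
  (if obsCount B t ω = 0 then 1 else 0) + √(L / 2) * (√(obsCount B t ω : ℝ))⁻¹ +
    |obsMean B Z t ω - μ|

lemma abs_obsMean_sub_le (h : AdaptiveSample P ℱ B Z μ) {ε : ℝ} (hε : 0 < ε) (t : ℕ) (ω : Ω)
    (h0 : obsCount B t ω ≠ 0) :
    |obsMean B Z t ω - μ| ≤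
      ε * (obsDev B Z μ t ω ^ 2 / (obsCount B t ω * (obsCount B t ω + 1))) + 1 / (2 * ε) := by
  have e : obsDev B Z μ t ω = obsCount B t ω * (obsMean B Z t ω - μ) := by
    rw [obsDev, ← h.obsCount_mul_obsMean]; ring
  have hn : (1 : ℝ) ≤ obsCount B t ω := by exact_mod_cast Nat.one_le_iff_ne_zero.2 h0
  rw [e]
  generalize (obsCount B t ω : ℝ) = n at *
  generalize obsMean B Z t ω - μ = x at *
  have e2 : (n * x) ^ 2 / (n * (n + 1)) = n / (n + 1) * |x| ^ 2 := by
    rw [sq_abs]; field_simp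
  have h2 : 1 / 2 ≤ n / (n + 1) := by
    rw [div_le_div_iff₀ (by norm_num) (by linarith)]; linarith
  have h3 : |x| ≤ ε * (1 / 2 * |x| ^ 2) + 1 / (2 * ε) := by
    have e3 : ε * (1 / 2 * |x| ^ 2) + 1 / (2 * ε) - |x| = (ε * |x| - 1) ^ 2 / (2 * ε) := by
      field_simp; ring
    have : 0 ≤ (ε * |x| - 1) ^ 2 / (2 * ε) := by positivity
    linarith
  rw [e2]
  refine h3.trans (add_le_add_left ?_ _)
  gcongr

lemma sum_width_le (h : AdaptiveSample P ℱ B Z μ) {ε L : ℝ} (hε : 0 < ε) (T : ℕ)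
    (hT : 1 ≤ T) (ω : Ω) :
    ∑ t ∈ Finset.Ico 1 T, (B t ω : ℝ) * width B Z μ L t ω ≤
      2 + √(L / 2) * (2 * √(obsCount B T ω : ℝ)) + ε * sqDev B Z μ T ω +
        obsCount B T ω * (1 / (2 * ε)) := by
  have hpt : ∀ t ∈ Finset.Ico 1 T, (B t ω : ℝ) * width B Z μ L t ω ≤
      (B t ω : ℝ) * (if obsCount B t ω = 0 then 2 else 0) +
      √(L / 2) * ((B t ω : ℝ) * (√(obsCount B t ω : ℝ))⁻¹) +
      ε * ((B t ω : ℝ) * (obsDev B Z μ t ω ^ 2 / (obsCount B t ω * (obsCount B t ω + 1)))) +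
      (B t ω : ℝ) * (1 / (2 * ε)) := by
    intro t _
    have hB : (0 : ℝ) ≤ B t ω := Nat.cast_nonneg _
    have hε' : 0 ≤ 1 / (2 * ε) := by positivity
    have : width B Z μ L t ω ≤ (if obsCount B t ω = 0 then 2 else 0) +
        √(L / 2) * (√(obsCount B t ω : ℝ))⁻¹ +
        ε * (obsDev B Z μ t ω ^ 2 / (obsCount B t ω * (obsCount B t ω + 1))) + 1 / (2 * ε) := by
      rw [width]
      by_cases h0 : obsCount B t ω = 0
      · have h1 := h.obsMean_mem t ω
        have hm := h.mean_mem
        have h2 : |obsMean B Z t ω - μ| ≤ 1 :=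
          abs_le.2 ⟨by linarith [h1.1, hm.2], by linarith [h1.2, hm.1]⟩
        simp only [h0, if_true, Nat.cast_zero, zero_mul, div_zero, mul_zero]
        linarith
      · rw [if_neg h0, if_neg h0]
        linarith [h.abs_obsMean_sub_le hε t ω h0]
    nlinarith
  refine (Finset.sum_le_sum hpt).trans ?_
  rw [Finset.sum_add_distrib, Finset.sum_add_distrib, Finset.sum_add_distrib, ← Finset.mul_sum,
    ← Finset.mul_sum, ← Finset.sum_mul, h.sum_obsCount_eq (fun n => if n = 0 then 2 else 0) hT,
    h.sum_obsCount_eq (fun n => (√(n : ℝ))⁻¹) hT]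
  have h1 : ∑ k ∈ Finset.range (obsCount B T ω), (if k = 0 then (2 : ℝ) else 0) ≤ 2 := by
    rw [Finset.sum_ite_eq']; split_ifs <;> norm_num
  have h2 := mul_le_mul_of_nonneg_left (sum_range_inv_sqrt_le (obsCount B T ω))
    (Real.sqrt_nonneg (L / 2))
  have h3 : (∑ t ∈ Finset.Ico 1 T, (B t ω : ℝ)) = obsCount B T ω := by
    rw [obsCount, Nat.cast_sum]
  rw [h3]
  exact add_le_add (add_le_add (add_le_add h1 h2) le_rfl) le_rfl

lemma measurable_width (h : AdaptiveSample P ℱ B Z μ) (L : ℝ) (t : ℕ) :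
    Measurable[ℱ t] (width B Z μ L t) := by
  have hf : Measurable[⊤] fun n : ℕ => (if n = 0 then (1 : ℝ) else 0) + √(L / 2) * (√(n : ℝ))⁻¹ :=
    measurable_from_top
  exact (hf.comp (h.measurable_obsCount t)).add
    (measurable_norm.comp ((h.measurable_obsMean t).sub_const μ))

lemma width_nonneg (L : ℝ) (t : ℕ) (ω : Ω) : 0 ≤ width B Z μ L t ω := by
  unfold width; positivity

lemma width_le (h : AdaptiveSample P ℱ B Z μ) (L : ℝ) (t : ℕ) (ω : Ω) :
    width B Z μ L t ω ≤ 2 + √(L / 2) := by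
  have h1 := h.obsMean_mem t ω
  have hm := h.mean_mem
  have h2 : |obsMean B Z t ω - μ| ≤ 1 :=
    abs_le.2 ⟨by linarith [h1.1, hm.2], by linarith [h1.2, hm.1]⟩
  have hs := Real.sqrt_nonneg (L / 2)
  rw [width]
  by_cases h0 : obsCount B t ω = 0
  · simp only [h0, if_true, Nat.cast_zero, Real.sqrt_zero, inv_zero, mul_zero]
    linarith
  · have hn : (1 : ℝ) ≤ √(obsCount B t ω : ℝ) :=
      Real.one_le_sqrt.2 (by exact_mod_cast Nat.one_le_iff_ne_zero.2 h0)
    have := mul_le_of_le_one_right hs (inv_le_one_of_one_le₀ hn)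
    rw [if_neg h0]
    linarith

end AdaptiveSample

section Program

variable {N M K : ℕ}

lemma meanCost_nonneg {p c : Fin N → Fin M → ℝ} {lam : Fin M → ℝ} (hp : p ∈ strategies N M)
    (hc : ∀ i j, 0 ≤ c i j) (hl : ∀ j, 0 ≤ lam j) : 0 ≤ meanCost p c lam :=
  Finset.sum_nonneg fun i _ => Finset.sum_nonneg fun j _ =>
    mul_nonneg (mul_nonneg (hp.1 i j).1 (hl j)) (hc i j)

lemma sum_strategy_mul {p : Fin N → Fin M → ℝ} (hp : p ∈ strategies N M) (x : Fin M → ℝ) :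
    ∑ i, ∑ j, p i j * x j = ∑ j, x j := by
  rw [Finset.sum_comm]
  exact Finset.sum_congr rfl fun j _ => by rw [← Finset.sum_mul, hp.2 j, one_mul]

lemma meanCost_le_one {p c : Fin N → Fin M → ℝ} {lam : Fin M → ℝ} (hp : p ∈ strategies N M)
    (hc : ∀ i j, c i j ≤ 1) (hl : ∀ j, 0 ≤ lam j) (hs : ∑ j, lam j = 1) :
    meanCost p c lam ≤ 1 := by
  rw [← hs, ← sum_strategy_mul hp lam]
  exact Finset.sum_le_sum fun i _ => Finset.sum_le_sum fun j _ =>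
    mul_le_of_le_one_right (mul_nonneg (hp.1 i j).1 (hl j)) (hc i j)

lemma meanCost_sub_mem (S : System N M K) {p q : Fin N → Fin M → ℝ} (hp : p ∈ strategies N M)
    (hq : q ∈ strategies N M) :
    meanCost p S.c S.lam - meanCost q S.c S.lam ∈ Set.Icc (-1 : ℝ) 1 := by
  have h := fun (r : Fin N → Fin M → ℝ) (hr : r ∈ strategies N M) =>
    And.intro (meanCost_nonneg hr (fun i j => (S.c_mem i j).1) S.lam_nonneg)
      (meanCost_le_one hr (fun i j => (S.c_mem i j).2) S.lam_nonneg S.lam_sum)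
  constructor <;> linarith [(h p hp).1, (h p hp).2, (h q hq).1, (h q hq).2]

lemma meanCost_eq_of_one_node (S : System 1 M K) {p q : Fin 1 → Fin M → ℝ}
    (hp : p ∈ strategies 1 M) (hq : q ∈ strategies 1 M) :
    meanCost p S.c S.lam = meanCost q S.c S.lam := by
  have h : p = q := by
    ext i j
    have h1 := hp.2 j
    have h2 := hq.2 j
    rw [Fin.sum_univ_one] at h1 h2
    rw [Subsingleton.elim i 0, h1, h2]
  rw [h]

lemma meanCost_eq_of_one_class (S : System N 1 K) (p q : Fin N → Fin 1 → ℝ) :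
    meanCost p S.c S.lam = meanCost q S.c S.lam := by
  have h : ∀ i j, S.c i j = 0 := fun i j => by
    rw [Subsingleton.elim j S.nul, S.c_nul]
  simp [meanCost, h]

/-- Moving a fraction of a strategy to the rejection node. -/
noncomputable def shrink (S : System N M K) (p : Fin N → Fin M → ℝ) (δ : ℝ) (i : Fin N)
    (j : Fin M) : ℝ :=
  (p i j + if i = S.rej then δ else 0) / (1 + δ)

lemma shrink_mem (S : System N M K) {p : Fin N → Fin M → ℝ} (hp : p ∈ strategies N M) {δ : ℝ}
    (hδ : 0 ≤ δ) : shrink S p δ ∈ strategies N M := by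
  have hδ' : 0 < 1 + δ := by linarith
  refine ⟨fun i j => ⟨?_, ?_⟩, fun j => ?_⟩
  · have := (hp.1 i j).1
    unfold shrink
    split_ifs <;> positivity
  · have := (hp.1 i j).2
    rw [shrink, div_le_one hδ']
    split_ifs <;> linarith
  · simp only [shrink]
    rw [← Finset.sum_div, Finset.sum_add_distrib, hp.2 j]
    simp [hδ'.ne']

lemma load_shrink_le (S : System N M K) {p : Fin N → Fin M → ℝ} (hp : p ∈ strategies N M)
    (hload : ∀ i k, load p S.kap i k ≤ 1) {kapU : Fin N → Fin M → Fin K → ℝ}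
    (hrej : ∀ j k, kapU S.rej j k = 0) {d : ℝ} (hd : 0 ≤ d)
    (hU : ∀ i j k, kapU i j k ≤ S.kap i j k + d) (i : Fin N) (k : Fin K) :
    load (shrink S p (M * d)) kapU i k ≤ 1 := by
  have hδ : (0 : ℝ) < 1 + M * d := by positivity
  by_cases hi : i = S.rej
  · simp [load, hi, hrej]
  · simp only [load, shrink, if_neg hi, add_zero]
    simp only [div_mul_eq_mul_div]
    rw [← Finset.sum_div, div_le_one hδ]
    calc ∑ j, p i j * kapU i j k ≤ ∑ j, (p i j * S.kap i j k + d) := by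
          refine Finset.sum_le_sum fun j _ => ?_
          have h1 := mul_le_mul_of_nonneg_left (hU i j k) (hp.1 i j).1
          have h2 := mul_le_of_le_one_left hd (hp.1 i j).2
          linarith
      _ = load p S.kap i k + M * d := by
          rw [Finset.sum_add_distrib, load]; simp
      _ ≤ 1 + M * d := by linarith [hload i k]

lemma meanCost_shrink_le (S : System N M K) {p c : Fin N → Fin M → ℝ} {lam : Fin M → ℝ}
    (hp : p ∈ strategies N M) (hc : ∀ i j, c i j ∈ Set.Icc (0 : ℝ) 1) (hl : ∀ j, 0 ≤ lam j)
    (hs : ∑ j, lam j ≤ 1) {δ : ℝ} (hδ : 0 ≤ δ) :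
    meanCost (shrink S p δ) c lam ≤ meanCost p c lam + δ := by
  have h0 := meanCost_nonneg hp (fun i j => (hc i j).1) hl
  have hδ' : 0 < 1 + δ := by linarith
  have h1 : meanCost (shrink S p δ) c lam ≤ (meanCost p c lam + δ) / (1 + δ) := by
    have e : meanCost (shrink S p δ) c lam =
        (meanCost p c lam + ∑ j, δ * lam j * c S.rej j) / (1 + δ) := by
      have : ∑ j, δ * lam j * c S.rej j =
          ∑ i, ∑ j, (if i = S.rej then δ else 0) * lam j * c i j := by
        rw [Finset.sum_eq_single S.rej]
        · simp
        · intro i _ hi; simp [hi]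
        · simp
      rw [this]
      simp only [meanCost, ← Finset.sum_add_distrib, Finset.sum_div, shrink]
      refine Finset.sum_congr rfl fun i _ => Finset.sum_congr rfl fun j _ => ?_
      ring
    rw [e]
    refine div_le_div_of_nonneg_right (add_le_add_right ?_ _) hδ'.le
    calc ∑ j, δ * lam j * c S.rej j ≤ ∑ j, δ * lam j :=
          Finset.sum_le_sum fun j _ => mul_le_of_le_one_right (mul_nonneg hδ (hl j)) (hc _ j).2
      _ ≤ δ := by rw [← Finset.mul_sum]; exact mul_le_of_le_one_right hδ hs
  exact h1.trans (div_le_self (by linarith) (by linarith))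

/-- Sensitivity of the placement program: the excess cost, under the true parameters, of a solution
of the program with perturbed parameters. -/
lemma meanCost_sub_le (S : System N M K) {p pstar : Fin N → Fin M → ℝ}
    {cL : Fin N → Fin M → ℝ} {lamL : Fin M → ℝ} {kapU : Fin N → Fin M → Fin K → ℝ}
    (hc : ∀ i j, cL i j ∈ Set.Icc (0 : ℝ) 1) (hl : ∀ j, 0 ≤ lamL j) (hs : ∑ j, lamL j ≤ 1)
    (hrej : ∀ j k, kapU S.rej j k = 0) {d : ℝ} (hd : 0 ≤ d)
    (hU : ∀ i j k, kapU i j k ≤ S.kap i j k + d)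
    (hp : IsOptimal cL lamL kapU p) (hstar : pstar ∈ strategies N M)
    (hload : ∀ i k, load pstar S.kap i k ≤ 1) :
    meanCost p S.c S.lam - meanCost pstar S.c S.lam ≤
      ∑ j ∈ Finset.univ.erase S.nul, max (S.lam j - lamL j) 0 +
      ∑ i, ∑ j, p i j * S.lam j * max (S.c i j - cL i j) 0 + M * d +
      ∑ j, max (lamL j - S.lam j) 0 +
      ∑ i, ∑ j, pstar i j * S.lam j * max (cL i j - S.c i j) 0 := by
  have hδ : (0 : ℝ) ≤ M * d := by positivity
  have hopt := hp.2 _ (shrink_mem S hstar hδ) (load_shrink_le S hstar hload hrej hd hU)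
  have hshr := meanCost_shrink_le S hstar hc hl hs hδ
  have hA : meanCost p S.c S.lam ≤ meanCost p cL lamL +
      (∑ j ∈ Finset.univ.erase S.nul, max (S.lam j - lamL j) 0 +
      ∑ i, ∑ j, p i j * S.lam j * max (S.c i j - cL i j) 0) := by
    have e : ∑ j ∈ Finset.univ.erase S.nul, max (S.lam j - lamL j) 0 =
        ∑ i, ∑ j, p i j * (if j = S.nul then 0 else max (S.lam j - lamL j) 0) := by
      rw [sum_strategy_mul hp.1.1, ← Finset.add_sum_erase Finset.univ
        (fun j => if j = S.nul then 0 else max (S.lam j - lamL j) 0) (Finset.mem_univ S.nul),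
        if_pos rfl, zero_add]
      exact Finset.sum_congr rfl fun j hj => by rw [if_neg (Finset.ne_of_mem_erase hj)]
    rw [e]
    simp only [meanCost, ← Finset.sum_add_distrib]
    refine Finset.sum_le_sum fun i _ => Finset.sum_le_sum fun j _ => ?_
    have hpij := (hp.1.1.1 i j).1
    have hcij := hc i j
    by_cases hj : j = S.nul
    · rw [if_pos hj, hj, S.c_nul]
      have h1 := mul_nonneg (mul_nonneg hpij (hl j)) hcij.1
      have h2 := mul_nonneg (mul_nonneg hpij (S.lam_nonneg j)) (le_max_right (0 - cL i j) 0)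
      rw [hj] at h1 h2
      linarith
    · rw [if_neg hj]
      have h1 := le_max_left (S.lam j - lamL j) 0
      have h2 := mul_le_of_le_one_right (le_max_right (S.lam j - lamL j) 0) hcij.2
      have h3 := mul_le_mul_of_nonneg_right h1 hcij.1
      have h4 := mul_le_mul_of_nonneg_left (le_max_left (S.c i j - cL i j) 0) (S.lam_nonneg j)
      have h5 : S.lam j * S.c i j ≤ lamL j * cL i j + (max (S.lam j - lamL j) 0 +
          S.lam j * max (S.c i j - cL i j) 0) := by linarith
      have h6 := mul_le_mul_of_nonneg_left h5 hpij
      linarith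
  have hC : meanCost pstar cL lamL ≤ meanCost pstar S.c S.lam +
      (∑ j, max (lamL j - S.lam j) 0 +
      ∑ i, ∑ j, pstar i j * S.lam j * max (cL i j - S.c i j) 0) := by
    rw [← sum_strategy_mul hstar fun j => max (lamL j - S.lam j) 0]
    simp only [meanCost, ← Finset.sum_add_distrib]
    refine Finset.sum_le_sum fun i _ => Finset.sum_le_sum fun j _ => ?_
    have hpij := (hstar.1 i j).1
    have hcij := hc i j
    have h1 := le_max_left (lamL j - S.lam j) 0
    have h2 := mul_le_of_le_one_right (le_max_right (lamL j - S.lam j) 0) hcij.2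
    have h3 := mul_le_mul_of_nonneg_right h1 hcij.1
    have h4 := mul_le_mul_of_nonneg_left (le_max_left (cL i j - S.c i j) 0) (S.lam_nonneg j)
    have h5 : lamL j * cL i j ≤ S.lam j * S.c i j + (max (lamL j - S.lam j) 0 +
        S.lam j * max (cL i j - S.c i j) 0) := by linarith
    have h6 := mul_le_mul_of_nonneg_left h5 hpij
    linarith
  linarith

end Program

lemma System.lam_mem {N M K : ℕ} (S : System N M K) (j : Fin M) :
    S.lam j ∈ Set.Icc (0 : ℝ) 1 :=
  ⟨S.lam_nonneg j, S.lam_sum ▸ Finset.single_le_sum (fun j _ => S.lam_nonneg j)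
    (Finset.mem_univ j)⟩

lemma integral_mul_eq_of_condExp {Ω : Type*} {m mΩ : MeasurableSpace Ω} {P : Measure Ω}
    [IsFiniteMeasure P] (hm : m ≤ mΩ) {f g φ : Ω → ℝ} (hf : Measurable[m] f) {b : ℝ}
    (hb : ∀ ω, ‖f ω‖ ≤ b) (hg : Integrable g P) (hφ : P[g | m] =ᵐ[P] φ) :
    ∫ ω, f ω * g ω ∂P = ∫ ω, f ω * φ ω ∂P := by
  have h1 := condExp_stronglyMeasurable_mul_of_bound hm hf.stronglyMeasurable hg b
    (Filter.Eventually.of_forall hb)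
  refine (integral_condExp (f := f * g) hm).symm.trans (integral_congr_ae ?_)
  filter_upwards [h1, hφ] with ω h2 h3
  rw [h2, Pi.mul_apply, h3]

namespace Run

variable {N M K : ℕ} {Ω : Type*} [mΩ : MeasurableSpace Ω] {P : Measure Ω}
  {S : System N M K} {ℱ : Filtration ℕ mΩ} {R : Run N M K Ω}

namespace IsEnvironment

lemma measurable_cls (h : R.IsEnvironment S ℱ P) {t : ℕ} (ht : 1 ≤ t) :
    Measurable[ℱ (t + 1)] (R.cls t) :=
  measurable_fst.comp (h.measurable_nature t ht)

lemma measurable_C (h : R.IsEnvironment S ℱ P) {t : ℕ} (ht : 1 ≤ t) (i : Fin N) (j : Fin M) :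
    Measurable[ℱ (t + 1)] fun ω => R.C t ω i j :=
  (measurable_pi_apply j).comp ((measurable_pi_apply i).comp
    (measurable_fst.comp (measurable_snd.comp (h.measurable_nature t ht))))

lemma integral_mul_nature (h : R.IsEnvironment S ℱ P) {t : ℕ} (ht : 1 ≤ t) {U : Ω → ℝ}
    (hU : Measurable[ℱ t] U)
    {g : Fin M × (Fin N → Fin M → ℝ) × (Fin N → Fin M → Fin K → ℝ) → ℝ} (hg : Measurable g) :
    ∫ ω, U ω * g (R.nature t ω) ∂P = (∫ ω, U ω ∂P) * ∫ ω, g (R.nature t ω) ∂P := by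
  have hn : Measurable (R.nature t) := (h.measurable_nature t ht).mono (ℱ.le _) le_rfl
  have hind : IndepFun U (fun ω => g (R.nature t ω)) P := by
    rw [IndepFun_iff_Indep]
    refine indep_of_indep_of_le_left (indep_of_indep_of_le_right (h.indep_past t ht) ?_)
      hU.comap_le
    rw [show (fun ω => g (R.nature t ω)) = g ∘ R.nature t from rfl, ← MeasurableSpace.comap_comp]
    exact MeasurableSpace.comap_mono hg.comap_le
  exact hind.integral_fun_mul_eq_mul_integral
    (hU.mono (ℱ.le t) le_rfl).aestronglyMeasurable (hg.comp hn).aestronglyMeasurable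

lemma use_mem (h : R.IsEnvironment S ℱ P) {t : ℕ} (ht : 1 ≤ t) (ω : Ω) (i : Fin N) (j : Fin M)
    (k : Fin K) : R.A t ω i j k * ((S.beta i k)⁻¹).toReal ∈ Set.Icc (0 : ℝ) 1 := by
  have h0 := h.A_nonneg t ht ω i j k
  refine ⟨mul_nonneg h0 ENNReal.toReal_nonneg, ?_⟩
  rw [← ENNReal.toReal_ofReal h0, ← ENNReal.toReal_mul]
  refine ENNReal.toReal_le_of_le_ofReal zero_le_one ?_
  rw [← div_eq_mul_inv, ENNReal.ofReal_one]
  exact ENNReal.div_le_of_le_mul (by simpa using h.A_le t ht ω i j k)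

lemma integral_cls (h : R.IsEnvironment S ℱ P) {t : ℕ} (ht : 1 ≤ t) (j : Fin M) :
    ∫ ω, (if R.cls t ω = j then (1 : ℝ) else 0) ∂P = S.lam j := by
  have hm : MeasurableSet {ω | R.cls t ω = j} :=
    (h.measurable_cls ht).mono (ℱ.le _) le_rfl (measurableSet_singleton j)
  rw [← h.law_cls t ht j, ← integral_indicator_one hm]
  exact integral_congr_ae (Filter.Eventually.of_forall fun ω => by simp [Set.indicator_apply])

lemma integral_cls_mul (h : R.IsEnvironment S ℱ P) {t : ℕ} (ht : 1 ≤ t) (j : Fin M)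
    {g : (Fin N → Fin M → ℝ) × (Fin N → Fin M → Fin K → ℝ) → ℝ} (hg : Measurable g) :
    ∫ ω, (if R.cls t ω = j then (1 : ℝ) else 0) * g (R.C t ω, R.A t ω) ∂P =
      S.lam j * ∫ ω, g (R.C t ω, R.A t ω) ∂P := by
  have hn : Measurable (R.nature t) := (h.measurable_nature t ht).mono (ℱ.le _) le_rfl
  have hf : Measurable fun x : Fin M => if x = j then (1 : ℝ) else 0 := measurable_from_top
  rw [← h.integral_cls ht j]
  exact ((h.indep_cls t ht).comp hf hg).integral_fun_mul_eq_mul_integral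
    (hf.comp (measurable_fst.comp hn)).aestronglyMeasurable
    (hg.comp (measurable_snd.comp hn)).aestronglyMeasurable

lemma integral_use (h : R.IsEnvironment S ℱ P) {t : ℕ} (ht : 1 ≤ t) (i : Fin N) (j : Fin M)
    (k : Fin K) :
    ∫ ω, (if R.cls t ω = j then R.A t ω i j k * ((S.beta i k)⁻¹).toReal else 0) ∂P =
      S.kap i j k := by
  have hg : Measurable fun x : (Fin N → Fin M → ℝ) × (Fin N → Fin M → Fin K → ℝ) =>
      x.2 i j k * ((S.beta i k)⁻¹).toReal := by fun_prop
  have := h.integral_cls_mul ht j hg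
  simp only [ite_mul, one_mul, zero_mul] at this
  rw [this, integral_mul_const, h.mean_A t ht, System.kap, mul_assoc]

variable [IsProbabilityMeasure P]

/-- The arrivals of a class, observed in every slot. -/
lemma sample_cls (h : R.IsEnvironment S ℱ P) (j : Fin M) :
    AdaptiveSample P ℱ (fun _ _ => 1) (fun t ω => if R.cls t ω = j then 1 else 0)
      (S.lam j) where
  measurable_B _ _ := measurable_const
  measurable_Z t ht :=
    (measurable_from_top : Measurable fun x : Fin M => if x = j then (1 : ℝ) else 0).comp
      (h.measurable_cls ht)
  B_le _ _ _ := le_rfl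
  Z_mem t _ ω := by split_ifs <;> simp
  mean_mem := S.lam_mem j
  unbiased t ht U hU _ := by
    have hf : Measurable fun x : Fin M => if x = j then (1 : ℝ) else 0 := measurable_from_top
    have hg : Measurable fun x : Fin M × (Fin N → Fin M → ℝ) × (Fin N → Fin M → Fin K → ℝ) =>
        ((1 : ℕ) : ℝ) * ((if x.1 = j then (1 : ℝ) else 0) - S.lam j) :=
      ((hf.comp measurable_fst).sub_const _).const_mul _
    refine (h.integral_mul_nature ht hU hg).trans ?_
    have hi : Integrable (fun ω => if R.cls t ω = j then (1 : ℝ) else 0) P :=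
      integrable_of_abs_le (b := 1) ((hf.comp (h.measurable_cls ht)).mono (ℱ.le _) le_rfl)
        fun ω => by split_ifs <;> simp
    have : ∫ ω, ((1 : ℕ) : ℝ) * ((if R.cls t ω = j then (1 : ℝ) else 0) - S.lam j) ∂P = 0 := by
      simp only [Nat.cast_one, one_mul]
      rw [integral_sub hi (integrable_const _), h.integral_cls ht j]
      simp
    exact mul_eq_zero_of_right _ this

/-- The normalized resource use of a class, observed in every slot. -/
lemma sample_use (h : R.IsEnvironment S ℱ P) (i : Fin N) (j : Fin M) (k : Fin K) :
    AdaptiveSample P ℱ (fun _ _ => 1)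
      (fun t ω => if R.cls t ω = j then R.A t ω i j k * ((S.beta i k)⁻¹).toReal else 0)
      (S.kap i j k) := by
  have hZ : ∀ t, 1 ≤ t → ∀ ω, (if R.cls t ω = j then R.A t ω i j k * ((S.beta i k)⁻¹).toReal
      else 0) ∈ Set.Icc (0 : ℝ) 1 := by
    intro t ht ω
    split_ifs
    · exact h.use_mem ht ω i j k
    · simp
  have hf : Measurable fun x : Fin M × (Fin N → Fin M → ℝ) × (Fin N → Fin M → Fin K → ℝ) =>
      (if x.1 = j then x.2.2 i j k * ((S.beta i k)⁻¹).toReal else 0) :=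
    Measurable.ite (measurable_fst (measurableSet_singleton j)) (by fun_prop) measurable_const
  have hZm : ∀ t, 1 ≤ t → Measurable[ℱ (t + 1)] fun ω =>
      if R.cls t ω = j then R.A t ω i j k * ((S.beta i k)⁻¹).toReal else 0 := fun t ht =>
    hf.comp (h.measurable_nature t ht)
  have hi : ∀ t, 1 ≤ t → Integrable (fun ω =>
      if R.cls t ω = j then R.A t ω i j k * ((S.beta i k)⁻¹).toReal else 0) P := fun t ht =>
    integrable_of_abs_le (b := 1) ((hZm t ht).mono (ℱ.le _) le_rfl) fun ω => by
      rw [abs_of_nonneg (hZ t ht ω).1]; exact (hZ t ht ω).2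
  refine ⟨fun _ _ => measurable_const, hZm, fun _ _ _ => le_rfl, hZ, ?_, ?_⟩
  · rw [← h.integral_use le_rfl i j k]
    refine ⟨integral_nonneg fun ω => (hZ 1 le_rfl ω).1, ?_⟩
    refine (integral_mono (hi 1 le_rfl) (integrable_const 1) fun ω => (hZ 1 le_rfl ω).2).trans ?_
    simp
  · intro t ht U hU _
    have hg : Measurable fun x : Fin M × (Fin N → Fin M → ℝ) × (Fin N → Fin M → Fin K → ℝ) =>
        ((1 : ℕ) : ℝ) * ((if x.1 = j then x.2.2 i j k * ((S.beta i k)⁻¹).toReal else 0) -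
          S.kap i j k) := (hf.sub_const _).const_mul _
    refine (h.integral_mul_nature ht hU hg).trans ?_
    have : ∫ ω, ((1 : ℕ) : ℝ) * ((if R.cls t ω = j then
        R.A t ω i j k * ((S.beta i k)⁻¹).toReal else 0) - S.kap i j k) ∂P = 0 := by
      simp only [Nat.cast_one, one_mul]
      rw [integral_sub (hi t ht) (integrable_const _), h.integral_use ht i j k]
      simp
    exact mul_eq_zero_of_right _ this

end IsEnvironment

namespace FollowsBaseAlgorithm

lemma measurable_phat_apply (hA : R.FollowsBaseAlgorithm S ℱ P) {t : ℕ} (ht : 1 ≤ t) (i : Fin N)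
    (j : Fin M) : Measurable[ℱ t] fun ω => R.phat t ω i j :=
  (measurable_pi_apply j).comp ((measurable_pi_apply i).comp (hA.measurable_phat t ht))

lemma abs_phat_le (hA : R.FollowsBaseAlgorithm S ℱ P) {t : ℕ} (ht : 1 ≤ t) (ω : Ω) (i : Fin N)
    (j : Fin M) : |R.phat t ω i j| ≤ 1 := by
  have := (hA.optimal t ht ω).1.1.1 i j
  rw [abs_of_nonneg this.1]
  exact this.2

end FollowsBaseAlgorithm

variable [IsProbabilityMeasure P]

/-- Indicator of the placement of a function of class `j` at node `i` in slot `t`. -/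
def hit (R : Run N M K Ω) (i : Fin N) (j : Fin M) (t : ℕ) (ω : Ω) : ℕ :=
  if R.cls t ω = j ∧ R.node t ω = i then 1 else 0

namespace FollowsBaseAlgorithm

lemma integral_mul_hit_mul (hA : R.FollowsBaseAlgorithm S ℱ P) (h : R.IsEnvironment S ℱ P) {t : ℕ}
    (ht : 1 ≤ t) (i : Fin N) (j : Fin M) {U : Ω → ℝ} (hU : Measurable[ℱ t] U) {b : ℝ}
    (hb : ∀ ω, |U ω| ≤ b)
    {g : Fin M × (Fin N → Fin M → ℝ) × (Fin N → Fin M → Fin K → ℝ) → ℝ} (hg : Measurable g)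
    {b' : ℝ} (hb' : ∀ ω, |g (R.nature t ω)| ≤ b') :
    ∫ ω, U ω * (R.hit i j t ω * g (R.nature t ω)) ∂P =
      (∫ ω, U ω * R.phat t ω i j ∂P) *
        ∫ ω, (if R.cls t ω = j then (1 : ℝ) else 0) * g (R.nature t ω) ∂P := by
  have hn : Measurable (R.nature t) := (h.measurable_nature t ht).mono (ℱ.le _) le_rfl
  have hnode : MeasurableSet {ω | R.node t ω = i} :=
    (h.measurable_node t ht).mono (ℱ.le _) le_rfl (measurableSet_singleton i)
  have hmle : (ℱ t : MeasurableSpace Ω) ⊔ MeasurableSpace.comap (R.nature t) inferInstance ≤ mΩ :=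
    sup_le (ℱ.le t) hn.comap_le
  have hclsg : Measurable fun x : Fin M × (Fin N → Fin M → ℝ) × (Fin N → Fin M → Fin K → ℝ) =>
      (if x.1 = j then (1 : ℝ) else 0) * g x :=
    (Measurable.ite (measurable_fst (measurableSet_singleton j)) measurable_const
      measurable_const).mul hg
  set f : Ω → ℝ := fun ω => U ω * ((if R.cls t ω = j then (1 : ℝ) else 0) * g (R.nature t ω))
    with hf
  have hfm : Measurable[(ℱ t : MeasurableSpace Ω) ⊔
      MeasurableSpace.comap (R.nature t) inferInstance] f :=
    (hU.mono le_sup_left le_rfl).mul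
      ((hclsg.comp (comap_measurable (R.nature t))).mono le_sup_right le_rfl)
  have hfb : ∀ ω, ‖f ω‖ ≤ b * (1 * b') := by
    intro ω
    rw [hf, Real.norm_eq_abs, abs_mul, abs_mul]
    have h1 : |if R.cls t ω = j then (1 : ℝ) else 0| ≤ 1 := by split_ifs <;> simp
    have hb0 := (abs_nonneg _).trans (hb ω)
    exact mul_le_mul (hb ω) (mul_le_mul h1 (hb' ω) (abs_nonneg _) zero_le_one)
      (mul_nonneg (abs_nonneg _) (abs_nonneg _)) hb0
  have hint : Integrable ({ω | R.node t ω = i}.indicator fun _ => (1 : ℝ)) P :=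
    (integrable_const 1).indicator hnode
  calc ∫ ω, U ω * (R.hit i j t ω * g (R.nature t ω)) ∂P
      = ∫ ω, f ω * {ω | R.node t ω = i}.indicator (fun _ => (1 : ℝ)) ω ∂P := by
        refine integral_congr_ae (Filter.Eventually.of_forall fun ω => ?_)
        simp only [hf, hit, Set.indicator_apply, Set.mem_ofPred_eq]
        by_cases h1 : R.cls t ω = j <;> by_cases h2 : R.node t ω = i <;> simp [h1, h2]
    _ = ∫ ω, f ω * R.phat t ω i (R.cls t ω) ∂P :=
        integral_mul_eq_of_condExp hmle hfm hfb hint (hA.draw t ht i)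
    _ = ∫ ω, (U ω * R.phat t ω i j) *
          ((if R.cls t ω = j then (1 : ℝ) else 0) * g (R.nature t ω)) ∂P := by
        refine integral_congr_ae (Filter.Eventually.of_forall fun ω => ?_)
        simp only [hf]
        by_cases h3 : R.cls t ω = j
        · simp only [h3, if_true]; ring
        · simp [h3]
    _ = _ := h.integral_mul_nature ht (hU.mul (hA.measurable_phat_apply ht i j)) hclsg

lemma integral_mul_hit (hA : R.FollowsBaseAlgorithm S ℱ P) (h : R.IsEnvironment S ℱ P) {t : ℕ}
    (ht : 1 ≤ t) (i : Fin N) (j : Fin M) {U : Ω → ℝ} (hU : Measurable[ℱ t] U) {b : ℝ}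
    (hb : ∀ ω, |U ω| ≤ b) :
    ∫ ω, U ω * R.hit i j t ω ∂P = (∫ ω, U ω * R.phat t ω i j ∂P) * S.lam j := by
  have := hA.integral_mul_hit_mul h ht i j hU hb (g := fun _ => 1) measurable_const
    (b' := 1) (by simp)
  simpa [h.integral_cls ht j] using this

/-- The costs of a class at a node, observed when a function is placed there. -/
lemma sample_cost (hA : R.FollowsBaseAlgorithm S ℱ P) (h : R.IsEnvironment S ℱ P) (i : Fin N)
    (j : Fin M) :
    AdaptiveSample P ℱ (R.hit i j) (fun t ω => R.C t ω i j) (S.c i j) where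
  measurable_B t ht := by
    have h1 := h.measurable_cls ht (measurableSet_singleton j)
    have h2 := h.measurable_node t ht (measurableSet_singleton i)
    exact Measurable.ite (h1.inter h2) measurable_const measurable_const
  measurable_Z t ht := h.measurable_C ht i j
  B_le t _ ω := by unfold hit; split_ifs <;> simp
  Z_mem t ht ω := h.C_mem t ht ω i j
  mean_mem := S.c_mem i j
  unbiased t ht U hU := by
    rintro ⟨b, hb⟩
    have hg' : Measurable fun x : (Fin N → Fin M → ℝ) × (Fin N → Fin M → Fin K → ℝ) =>
        x.1 i j - S.c i j := by fun_prop
    have hC := h.C_mem t ht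
    have hi : Integrable (fun ω => R.C t ω i j) P :=
      integrable_of_abs_le (b := 1) ((h.measurable_C ht i j).mono (ℱ.le _) le_rfl) fun ω => by
        rw [abs_of_nonneg (hC ω i j).1]; exact (hC ω i j).2
    refine (hA.integral_mul_hit_mul h ht i j hU hb (hg'.comp measurable_snd) (b' := 1)
      fun ω => ?_).trans ?_
    · have h1 := hC ω i j
      have h2 := S.c_mem i j
      exact abs_le.2 ⟨by simp only [nature, Function.comp_apply]; linarith [h1.1, h2.2],
        by simp only [nature, Function.comp_apply]; linarith [h1.2, h2.1]⟩
    · have h1 := h.integral_cls_mul ht j hg'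
      have h2 : ∫ ω, (R.C t ω i j - S.c i j) ∂P = 0 := by
        rw [integral_sub hi (integrable_const _), h.mean_C t ht]
        simp
      simp only [h2, mul_zero] at h1
      simp only [nature, Function.comp_apply, h1, mul_zero]

end FollowsBaseAlgorithm

end Run

lemma exp_neg_pred_mul_log_div_le {t : ℕ} (ht : 1 ≤ t) :
    Real.exp (-((t - 1 : ℕ) * (Real.log t / t))) ≤ 2 / t := by
  have ht' : (0 : ℝ) < t := by exact_mod_cast ht
  have h2 : Real.log t ≤ t * Real.log 2 := by
    rw [← Real.log_pow]
    exact Real.log_le_log ht' (by exact_mod_cast Nat.lt_two_pow_self.le)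
  have h3 : Real.log t / t ≤ Real.log 2 := by rw [div_le_iff₀ ht']; linarith
  have h4 : Real.log t / t * t = Real.log t := div_mul_cancel₀ _ ht'.ne'
  rw [← Real.exp_log (by positivity : (0 : ℝ) < 2 / t), Real.log_div two_ne_zero ht'.ne']
  apply Real.exp_le_exp.2
  push_cast [ht]
  linarith

/-- The radius of the confidence bounds on means observed in every slot. -/
noncomputable def radius (t : ℕ) : ℝ := √(Real.log t / (2 * t))

lemma radius_nonneg (t : ℕ) : 0 ≤ radius t := Real.sqrt_nonneg _

lemma two_mul_radius_sq {t : ℕ} (ht : 1 ≤ t) : 2 * radius t ^ 2 = Real.log t / t := by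
  have h : 0 ≤ Real.log t := Real.log_nonneg (by exact_mod_cast ht)
  rw [radius, Real.sq_sqrt (by positivity)]
  field_simp

lemma two_mul_radius (t : ℕ) : 2 * radius t = √2 * (√(Real.log t) * (√(t : ℝ))⁻¹) := by
  have h2 : √(2 : ℝ) ^ 2 = 2 := Real.sq_sqrt (by norm_num)
  have h2' : √(2 : ℝ) ≠ 0 := by positivity
  rw [radius, Real.sqrt_div' _ (by positivity), Real.sqrt_mul (by norm_num)]
  rw [div_eq_mul_inv, mul_inv, show (2 : ℝ) = √2 ^ 2 from h2.symm, Real.sqrt_sq (by positivity)]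
  field_simp

namespace AdaptiveSample

variable {Ω : Type*} {mΩ : MeasurableSpace Ω} {P : Measure Ω}
  {ℱ : Filtration ℕ mΩ} {B : ℕ → Ω → ℕ} {Z : ℕ → Ω → ℝ} {μ : ℝ} {t : ℕ}

lemma obsCount_one (t : ℕ) (ω : Ω) : obsCount (fun _ _ => 1) t ω = t - 1 := by
  simp [obsCount]

lemma max_lcb_sub_le (h : AdaptiveSample P ℱ B Z μ) (ρ : ℕ → ℝ) (ω : Ω) (hρ : ∀ n, 0 ≤ ρ n) :
    max (lcb (obsCount B t ω) t (obsMean B Z t ω) - μ) 0 ≤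
      ∑ n ∈ Finset.Ico 1 t,
        (ρ n * {ω | obsCount B t ω = n ∧ μ < obsMean B Z t ω ∧
          ENNReal.ofReal (Real.log t / n) < bernKL (obsMean B Z t ω) μ}.indicator (fun _ => 1) ω +
        {ω | obsCount B t ω = n}.indicator (fun ω => max (obsMean B Z t ω - μ - ρ n) 0) ω) := by
  have hnn : ∀ n ∈ Finset.Ico 1 t, 0 ≤
      ρ n * {ω | obsCount B t ω = n ∧ μ < obsMean B Z t ω ∧
          ENNReal.ofReal (Real.log t / n) < bernKL (obsMean B Z t ω) μ}.indicator (fun _ => 1) ω +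
        {ω | obsCount B t ω = n}.indicator (fun ω => max (obsMean B Z t ω - μ - ρ n) 0) ω :=
    fun n _ => add_nonneg (mul_nonneg (hρ n) (Set.indicator_nonneg (fun _ _ => zero_le_one) _))
      (Set.indicator_nonneg (fun _ _ => le_max_right _ _) _)
  refine max_le ?_ (Finset.sum_nonneg hnn)
  by_cases hlt : μ < lcb (obsCount B t ω) t (obsMean B Z t ω)
  · have hself := lcb_le_self (w := obsCount B t ω) (t := t) (h.obsMean_mem t ω)
    have hn0 : 1 ≤ obsCount B t ω := by
      by_contra hc
      have h0 : obsCount B t ω = 0 := by omega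
      have : obsMean B Z t ω = 0 := by simp [obsMean, h0]
      linarith [h.mean_mem.1]
    have hmem : obsCount B t ω ∈ Finset.Ico 1 t :=
      Finset.mem_Ico.2 ⟨hn0, by have := h.obsCount_le t ω; omega⟩
    refine le_trans ?_ (Finset.single_le_sum hnn hmem)
    have hkl := bernKL_gt_of_lt_lcb (h.obsMean_mem t ω) hn0 h.mean_mem hlt
    rw [Set.indicator_of_mem (by exact ⟨rfl, hkl⟩), Set.indicator_of_mem (by exact rfl)]
    linarith [le_max_left (obsMean B Z t ω - μ - ρ (obsCount B t ω)) 0]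
  · exact (sub_nonpos.2 (not_lt.1 hlt)).trans (Finset.sum_nonneg hnn)

lemma max_sub_lcb_le_width (h : AdaptiveSample P ℱ B Z μ) {T : ℕ} (ht : 1 ≤ t) (htT : t ≤ T)
    (ω : Ω) :
    max (μ - lcb (obsCount B t ω) t (obsMean B Z t ω)) 0 ≤ width B Z μ (Real.log T) t ω := by
  refine max_le ?_ (width_nonneg _ _ _)
  rw [width]
  by_cases h0 : obsCount B t ω = 0
  · have h1 : 0 ≤ lcb (obsCount B t ω) t (obsMean B Z t ω) := lcb_nonneg
    have h2 := h.mean_mem.2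
    have h3 : 0 ≤ √(Real.log T / 2) * (√(obsCount B t ω : ℝ))⁻¹ := by positivity
    rw [if_pos h0]
    linarith [abs_nonneg (obsMean B Z t ω - μ)]
  · have h1 := self_sub_le_lcb (t := t) (h.obsMean_mem t ω) (Nat.one_le_iff_ne_zero.2 h0) ht
    have h2 : √(Real.log t / (2 * obsCount B t ω)) ≤
        √(Real.log T / 2) * (√(obsCount B t ω : ℝ))⁻¹ := by
      rw [← div_div, Real.sqrt_div' _ (Nat.cast_nonneg _), div_eq_mul_inv]
      refine mul_le_mul_of_nonneg_right (Real.sqrt_le_sqrt ?_) (by positivity)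
      have : Real.log t ≤ Real.log T :=
        Real.log_le_log (by exact_mod_cast ht) (by exact_mod_cast htT)
      linarith
    rw [if_neg h0]
    linarith [neg_abs_le (obsMean B Z t ω - μ)]

variable [IsProbabilityMeasure P]

lemma measureReal_lt_lcb (h : AdaptiveSample P ℱ (fun _ _ => 1) Z μ) (ht : 2 ≤ t) :
    P.real {ω | μ < lcb t t (obsMean (fun _ _ => 1) Z t ω)} ≤ 2 / t := by
  have ht1 : 1 ≤ t := by omega
  have hl : 0 ≤ Real.log t := Real.log_nonneg (by exact_mod_cast ht1)
  refine le_trans (measureReal_mono fun ω hω => ?_)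
    ((h.measureReal_bernKL_le ht1 (t - 1) (by positivity : 0 ≤ Real.log t / t)).trans
      (exp_neg_pred_mul_log_div_le ht1))
  exact ⟨obsCount_one t ω, bernKL_gt_of_lt_lcb (h.obsMean_mem t ω) ht1 h.mean_mem hω⟩

lemma measureReal_ucb_lt (h : AdaptiveSample P ℱ (fun _ _ => 1) Z μ) (ht : 2 ≤ t) :
    P.real {ω | ucb t t (obsMean (fun _ _ => 1) Z t ω) < μ} ≤ 2 / t := by
  have ht1 : 1 ≤ t := by omega
  have hl : 0 ≤ Real.log t := Real.log_nonneg (by exact_mod_cast ht1)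
  refine le_trans (measureReal_mono fun ω hω => ?_)
    ((h.compl.measureReal_bernKL_le ht1 (t - 1) (by positivity : 0 ≤ Real.log t / t)).trans
      (exp_neg_pred_mul_log_div_le ht1))
  have h0 : obsCount (fun (_ : ℕ) (_ : Ω) => 1) t ω ≠ 0 := by rw [obsCount_one]; omega
  have h1 := bernKL_gt_of_ucb_lt (h.obsMean_mem t ω) ht1 h.mean_mem hω
  refine ⟨obsCount_one t ω, ?_⟩
  rw [obsMean_compl h0, bernKL_one_sub]
  exact ⟨by linarith [h1.1], h1.2⟩

lemma measureReal_lt_ucb (h : AdaptiveSample P ℱ (fun _ _ => 1) Z μ) (ht : 2 ≤ t) :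
    P.real {ω | μ + 2 * radius t < ucb t t (obsMean (fun _ _ => 1) Z t ω)} ≤ 2 / t := by
  have ht1 : 1 ≤ t := by omega
  refine le_trans (measureReal_mono fun ω hω => ?_)
    ((h.measureReal_dev_le ht1 (t - 1) (radius_nonneg t)).trans
      (by rw [two_mul_radius_sq ht1]; exact exp_neg_pred_mul_log_div_le ht1))
  have h1 := ucb_le_self_add (h.obsMean_mem t ω) ht1 ht1
  have h2 : μ + 2 * radius t < ucb t t (obsMean (fun _ _ => 1) Z t ω) := hω
  refine ⟨obsCount_one t ω, ?_⟩
  rw [radius] at *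
  linarith

lemma measureReal_lcb_lt (h : AdaptiveSample P ℱ (fun _ _ => 1) Z μ) (ht : 2 ≤ t) :
    P.real {ω | lcb t t (obsMean (fun _ _ => 1) Z t ω) < μ - 2 * radius t} ≤ 2 / t := by
  have ht1 : 1 ≤ t := by omega
  refine le_trans (measureReal_mono fun ω hω => ?_)
    ((h.compl.measureReal_dev_le ht1 (t - 1) (radius_nonneg t)).trans
      (by rw [two_mul_radius_sq ht1]; exact exp_neg_pred_mul_log_div_le ht1))
  have h0 : obsCount (fun (_ : ℕ) (_ : Ω) => 1) t ω ≠ 0 := by rw [obsCount_one]; omega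
  have h1 := self_sub_le_lcb (h.obsMean_mem t ω) ht1 ht1
  have h2 : lcb t t (obsMean (fun _ _ => 1) Z t ω) < μ - 2 * radius t := hω
  refine ⟨obsCount_one t ω, ?_⟩
  rw [obsMean_compl h0]
  rw [radius] at *
  linarith

/-- The mean excess of the lower confidence bound of an adaptively sampled mean. -/
lemma meanLE_lcb_sub (h : AdaptiveSample P ℱ B Z μ) (ht : 2 ≤ t) :
    MeanLE P (fun ω => max (lcb (obsCount B t ω) t (obsMean B Z t ω) - μ) 0)
      (5 / 2 * (√(Real.log t) * (√(t : ℝ))⁻¹)) := by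
  have ht1 : 1 ≤ t := by omega
  have ht0 : (0 : ℝ) < t := by exact_mod_cast ht1
  have hl2 : Real.log 2 ≤ Real.log t := Real.log_le_log (by norm_num) (by exact_mod_cast ht)
  have hlog := Real.log_two_gt_d9
  set L := Real.log t with hL
  have hL0 : 0 < L := by linarith
  set a := √(L / 2) with ha
  have ha0 : 0 < a := Real.sqrt_pos.2 (by linarith)
  have ha2 : a ^ 2 = L / 2 := Real.sq_sqrt (by linarith)
  set ρ : ℕ → ℝ := fun n => a * (√(n : ℝ))⁻¹ with hρ
  have hρ0 : ∀ n, 0 ≤ ρ n := fun n => by positivity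
  have hterm : ∀ n ∈ Finset.Ico 1 t, MeanLE P (fun ω =>
      ρ n * {ω | obsCount B t ω = n ∧ μ < obsMean B Z t ω ∧
          ENNReal.ofReal (L / n) < bernKL (obsMean B Z t ω) μ}.indicator (fun _ => 1) ω +
        {ω | obsCount B t ω = n}.indicator (fun ω => max (obsMean B Z t ω - μ - ρ n) 0) ω)
      ((a + 1 / (4 * a)) / t * (√(n : ℝ))⁻¹) := by
    intro n hn
    have hn1 : 1 ≤ n := (Finset.mem_Ico.1 hn).1
    have hn0 : (0 : ℝ) < n := by exact_mod_cast hn1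
    have hs0 : 0 < √(n : ℝ) := Real.sqrt_pos.2 hn0
    have hs2 : √(n : ℝ) ^ 2 = n := Real.sq_sqrt hn0.le
    have hexp : Real.exp (-(n * (L / n))) = 1 / t := by
      rw [mul_div_cancel₀ _ hn0.ne', Real.exp_neg, hL, Real.exp_log ht0, one_div]
    have hsq : 2 * ρ n ^ 2 = L / n := by
      rw [hρ]
      simp only [mul_pow, inv_pow, hs2, ha2]
      field_simp
    have h1 := MeanLE.indicator (h.measureReal_bernKL_le ht1 n (by positivity : 0 ≤ L / n))
    have h2 := h.meanLE_dev ht1 hn1 (r := ρ n) (by positivity)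
    rw [hexp] at h1
    rw [hsq, hexp] at h2
    refine ((h1.const_mul (hρ0 n)).add h2).mono (fun _ => le_rfl) (le_of_eq ?_)
    have e : 4 * (n : ℝ) * ρ n = 4 * a * √(n : ℝ) := by
      simp only [hρ]; field_simp; linarith
    rw [e, hρ]
    field_simp
  refine (MeanLE.sum _ hterm).mono (fun ω => h.max_lcb_sub_le ρ ω hρ0) ?_
  rw [← Finset.mul_sum]
  have hsum : ∑ n ∈ Finset.Ico 1 t, (√(n : ℝ))⁻¹ ≤ 2 * √(t : ℝ) :=
    (Finset.sum_le_sum_of_subset_of_nonneg (fun n hn => Finset.mem_range.2 (Finset.mem_Ico.1 hn).2)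
      fun _ _ _ => by positivity).trans (sum_range_inv_sqrt_le t)
  refine (mul_le_mul_of_nonneg_left hsum (by positivity)).trans ?_
  have hst : √(t : ℝ) ^ 2 = t := Real.sq_sqrt ht0.le
  have hst0 : 0 < √(t : ℝ) := Real.sqrt_pos.2 ht0
  have hLa : √L = √2 * a := by
    rw [ha, ← Real.sqrt_mul (by norm_num)]; congr 1; ring
  have hs : (1.414 : ℝ) ≤ √2 := Real.le_sqrt_of_sq_le (by norm_num)
  have hkey : 2 * (a + 1 / (4 * a)) ≤ 5 / 2 * (√2 * a) := by
    have h3 : 2 * (a + 1 / (4 * a)) = (2 * a ^ 2 + 1 / 2) / a := by field_simp; ring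
    rw [h3, div_le_iff₀ ha0]
    nlinarith
  rw [hLa]
  have e : (a + 1 / (4 * a)) / t * (2 * √(t : ℝ)) = 2 * (a + 1 / (4 * a)) * (√(t : ℝ))⁻¹ := by
    field_simp; linarith
  rw [e, ← mul_assoc]
  exact mul_le_mul_of_nonneg_right hkey (by positivity)

end AdaptiveSample

namespace Run

variable {N M K : ℕ} {Ω : Type*} {S : System N M K} {R : Run N M K Ω} {t : ℕ}

lemma cast_pred_eq (ht : 1 ≤ t) : (t : ℝ) - 1 = ((t - 1 : ℕ) : ℝ) := by push_cast [ht]; ring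

lemma lamHat_eq (ht : 1 ≤ t) (ω : Ω) (j : Fin M) :
    R.lamHat t ω j =
      obsMean (fun _ _ => 1) (fun t ω => if R.cls t ω = j then (1 : ℝ) else 0) t ω := by
  rw [lamHat, obsMean, AdaptiveSample.obsCount_one, cast_pred_eq ht, classCount, obsSum]
  push_cast
  simp

lemma kapHat_eq (ht : 1 ≤ t) (ω : Ω) (i : Fin N) (j : Fin M) (k : Fin K) :
    R.kapHat S t ω i j k = obsMean (fun _ _ => 1)
      (fun t ω => if R.cls t ω = j then R.A t ω i j k * ((S.beta i k)⁻¹).toReal else 0) t ω := by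
  rw [kapHat, obsMean, AdaptiveSample.obsCount_one, cast_pred_eq ht, obsSum]
  simp

lemma cHat_eq (ω : Ω) (i : Fin N) (j : Fin M) :
    R.cHat t ω i j = obsMean (R.hit i j) (fun t ω => R.C t ω i j) t ω := by
  rw [cHat, obsMean, obsSum]
  refine congrArg₂ _ (Finset.sum_congr rfl fun s _ => ?_) rfl
  unfold hit
  split_ifs <;> simp

lemma cLow_eq (ω : Ω) (i : Fin N) (j : Fin M) :
    R.cLow t ω i j = lcb (obsCount (R.hit i j) t ω) t
      (obsMean (R.hit i j) (fun t ω => R.C t ω i j) t ω) := by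
  rw [cLow, cHat_eq]; rfl

lemma sum_lamHat (ht : 2 ≤ t) (ω : Ω) : ∑ j, R.lamHat t ω j = 1 := by
  have h : ∑ j, R.classCount t ω j = t - 1 := by
    simp only [classCount]
    rw [Finset.sum_comm]
    simp
  have h0 : ((t - 1 : ℕ) : ℝ) ≠ 0 := by
    have : t - 1 ≠ 0 := by omega
    exact_mod_cast this
  simp only [lamHat]
  rw [← Finset.sum_div, ← Nat.cast_sum, h, cast_pred_eq (by omega), div_self h0]

lemma sum_obsCount_hit (T : ℕ) (ω : Ω) :
    ∑ i, ∑ j, (obsCount (R.hit i j) (T + 1) ω : ℝ) = T := by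
  have h : ∑ i, ∑ j, obsCount (R.hit i j) (T + 1) ω = T := by
    simp only [obsCount, hit, ite_and]
    have : ∀ s, ∑ i, ∑ j, (if R.cls s ω = j then if R.node s ω = i then 1 else 0 else 0) = 1 := by
      intro s; simp
    calc ∑ i, ∑ j, ∑ s ∈ Finset.Ico 1 (T + 1),
          (if R.cls s ω = j then if R.node s ω = i then 1 else 0 else 0)
        = ∑ s ∈ Finset.Ico 1 (T + 1), ∑ i, ∑ j,
          (if R.cls s ω = j then if R.node s ω = i then 1 else 0 else 0) := by
          simp only [Finset.sum_comm (t := Finset.Ico 1 (T + 1))]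
      _ = T := by simp only [this]; simp
  exact_mod_cast h

variable [mΩ : MeasurableSpace Ω] {P : Measure Ω} {ℱ : Filtration ℕ mΩ}

lemma measurableSet_feasible (hA : R.FollowsBaseAlgorithm S ℱ P) (ht : 1 ≤ t) :
    MeasurableSet (R.feasible S t) := by
  have hm : ∀ i j, Measurable fun ω => R.phat t ω i j := fun i j =>
    (hA.measurable_phat_apply ht i j).mono (ℱ.le t) le_rfl
  simp only [feasible, Set.ofPred_forall]
  refine MeasurableSet.iInter fun i => MeasurableSet.iInter fun k => ?_
  refine measurableSet_le ?_ measurable_const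
  exact Finset.measurable_fun_sum _ fun j _ => (hm i j).mul_const _

/-- The excess cost of the policy of slot `t`. -/
noncomputable def excess (S : System N M K) (R : Run N M K Ω) (pstar : Fin N → Fin M → ℝ) (t : ℕ)
    (ω : Ω) : ℝ :=
  meanCost (R.phat t ω) S.c S.lam - meanCost pstar S.c S.lam

lemma excess_mem (hA : R.FollowsBaseAlgorithm S ℱ P) (ht : 1 ≤ t)
    {pstar : Fin N → Fin M → ℝ} (hp : pstar ∈ strategies N M) (ω : Ω) :
    excess S R pstar t ω ∈ Set.Icc (-1 : ℝ) 1 :=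
  meanCost_sub_mem S (hA.optimal t ht ω).1.1 hp

variable [IsProbabilityMeasure P]

lemma measureReal_kapUp_lt (h : R.IsEnvironment S ℱ P) (ht : 2 ≤ t) (i : Fin N) (j : Fin M)
    (k : Fin K) : P.real {ω | R.kapUp S t ω i j k < S.kap i j k} ≤ 2 / t := by
  by_cases hb : S.beta i k = ⊤
  · have : {ω | R.kapUp S t ω i j k < S.kap i j k} = ∅ := by
      ext ω; simp [kapUp, hb, System.kap]
    rw [this, measureReal_empty]
    positivity
  · refine le_trans (le_of_eq ?_) ((h.sample_use i j k).measureReal_ucb_lt ht)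
    congr 1; ext ω
    simp only [Set.mem_ofPred_eq, kapUp, if_neg hb]
    rw [kapHat_eq (by omega)]

lemma measureReal_lt_kapUp (h : R.IsEnvironment S ℱ P) (ht : 2 ≤ t) (i : Fin N) (j : Fin M)
    (k : Fin K) :
    P.real {ω | S.kap i j k + 2 * radius t < R.kapUp S t ω i j k} ≤ 2 / t := by
  by_cases hb : S.beta i k = ⊤
  · have : {ω | S.kap i j k + 2 * radius t < R.kapUp S t ω i j k} = ∅ := by
      ext ω; simp [kapUp, hb, System.kap, radius_nonneg]
    rw [this, measureReal_empty]
    positivity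
  · refine le_trans (le_of_eq ?_) ((h.sample_use i j k).measureReal_lt_ucb ht)
    congr 1; ext ω
    simp only [Set.mem_ofPred_eq, kapUp, if_neg hb]
    rw [kapHat_eq (by omega)]

lemma measureReal_lt_lamLow (h : R.IsEnvironment S ℱ P) (ht : 2 ≤ t) (j : Fin M) :
    P.real {ω | S.lam j < R.lamLow t ω j} ≤ 2 / t := by
  refine le_trans (le_of_eq ?_) ((h.sample_cls j).measureReal_lt_lcb ht)
  congr 1; ext ω
  simp only [Set.mem_ofPred_eq, lamLow]
  rw [lamHat_eq (by omega)]

lemma measureReal_lamLow_lt (h : R.IsEnvironment S ℱ P) (ht : 2 ≤ t) (j : Fin M) :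
    P.real {ω | R.lamLow t ω j < S.lam j - 2 * radius t} ≤ 2 / t := by
  refine le_trans (le_of_eq ?_) ((h.sample_cls j).measureReal_lcb_lt ht)
  congr 1; ext ω
  simp only [Set.mem_ofPred_eq, lamLow]
  rw [lamHat_eq (by omega)]

lemma measureReal_infeasible_le (h : R.IsEnvironment S ℱ P) (hA : R.FollowsBaseAlgorithm S ℱ P)
    (ht : 2 ≤ t) : P.real (R.feasible S t)ᶜ ≤ N * M * K * (2 / t) := by
  have hsub : (R.feasible S t)ᶜ ⊆ ⋃ x ∈ (Finset.univ : Finset (Fin N × Fin M × Fin K)),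
      {ω | R.kapUp S t ω x.1 x.2.1 x.2.2 < S.kap x.1 x.2.1 x.2.2} := by
    intro ω hω
    by_contra hc
    simp only [Finset.mem_univ, Set.iUnion_true, Set.mem_iUnion, Set.mem_ofPred_eq, not_exists,
      not_lt] at hc
    refine hω fun i k => le_trans ?_ ((hA.optimal t (by omega) ω).1.2 i k)
    exact Finset.sum_le_sum fun j _ => mul_le_mul_of_nonneg_left (hc (i, j, k))
      ((hA.optimal t (by omega) ω).1.1.1 i j).1
  refine (measureReal_mono hsub (measure_ne_top _ _)).trans
    ((measureReal_biUnion_finset_le _ _).trans ?_)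
  refine (Finset.sum_le_card_nsmul _ _ (2 / (t : ℝ)) fun x _ =>
    measureReal_kapUp_lt h ht _ _ _).trans (le_of_eq ?_)
  simp [mul_assoc]

lemma measureReal_feasible_ge (h : R.IsEnvironment S ℱ P) (hA : R.FollowsBaseAlgorithm S ℱ P)
    (ht : 2 ≤ t) : 1 - N * M * K * (2 / t) ≤ P.real (R.feasible S t) := by
  have h1 := measureReal_infeasible_le h hA ht
  rw [probReal_compl_eq_one_sub (measurableSet_feasible hA (by omega))] at h1
  linarith

lemma integrable_excess (hA : R.FollowsBaseAlgorithm S ℱ P) (ht : 1 ≤ t)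
    (pstar : Fin N → Fin M → ℝ) : Integrable (excess S R pstar t) P := by
  have hm : ∀ i j, Integrable (fun ω => R.phat t ω i j) P := fun i j =>
    integrable_of_abs_le ((hA.measurable_phat_apply ht i j).mono (ℱ.le t) le_rfl)
      fun ω => hA.abs_phat_le ht ω i j
  refine Integrable.sub (integrable_finsetSum _ fun i _ => integrable_finsetSum _ fun j _ => ?_)
    (integrable_const _)
  exact ((hm i j).mul_const _).mul_const _

/-- The part of the excess cost in slot `t` that is not due to the uncertainty on the costs of
the policy in use. -/
noncomputable def slack (S : System N M K) (R : Run N M K Ω) (pstar : Fin N → Fin M → ℝ) (t : ℕ)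
    (ω : Ω) : ℝ :=
  ∑ j ∈ Finset.univ.erase S.nul,
      (2 * radius t + {ω | R.lamLow t ω j < S.lam j - 2 * radius t}.indicator (fun _ => 1) ω) +
    M * (2 * radius t) +
    ∑ j, {ω | S.lam j < R.lamLow t ω j}.indicator (fun _ => 1) ω +
    ∑ i, ∑ j, pstar i j * S.lam j * max (R.cLow t ω i j - S.c i j) 0 +
    ∑ i, ∑ j, ∑ k,
      {ω | S.kap i j k + 2 * radius t < R.kapUp S t ω i j k}.indicator (fun _ => 1) ω

lemma excess_le (h : R.IsEnvironment S ℱ P) (hA : R.FollowsBaseAlgorithm S ℱ P) {T : ℕ}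
    (ht : 2 ≤ t) (htT : t ≤ T) {pstar : Fin N → Fin M → ℝ}
    (hp : IsOptimal S.c S.lam S.kap pstar) (ω : Ω) :
    excess S R pstar t ω ≤ slack S R pstar t ω +
      ∑ i, ∑ j, R.phat t ω i j * S.lam j *
        AdaptiveSample.width (R.hit i j) (fun t ω => R.C t ω i j) (S.c i j) (Real.log T) t ω := by
  have ht1 : 1 ≤ t := by omega
  have hopt := hA.optimal t ht1 ω
  have hind : ∀ (E : Set Ω) (ω : Ω), (0 : ℝ) ≤ E.indicator (fun _ => 1) ω := fun E ω =>
    Set.indicator_nonneg (fun _ _ => zero_le_one) ω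
  have hr := radius_nonneg t
  have hlamHat : ∀ j, R.lamHat t ω j ∈ Set.Icc (0 : ℝ) 1 := fun j => by
    rw [lamHat_eq ht1]; exact (h.sample_cls j).obsMean_mem t ω
  have hlam0 : ∀ j, 0 ≤ R.lamLow t ω j := fun j => lcb_nonneg
  have hlam1 : ∀ j, R.lamLow t ω j ≤ R.lamHat t ω j := fun j => lcb_le_self (hlamHat j)
  have hX1 : 0 ≤ ∑ j ∈ Finset.univ.erase S.nul,
      (2 * radius t + {ω | R.lamLow t ω j < S.lam j - 2 * radius t}.indicator
        (fun _ => (1 : ℝ)) ω) :=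
    Finset.sum_nonneg fun j _ => add_nonneg (by linarith) (hind _ _)
  have hX2 : 0 ≤ M * (2 * radius t) := by positivity
  have hX3 : 0 ≤ ∑ j, {ω | S.lam j < R.lamLow t ω j}.indicator (fun _ => (1 : ℝ)) ω :=
    Finset.sum_nonneg fun j _ => hind _ _
  have hX4 : 0 ≤ ∑ i, ∑ j, pstar i j * S.lam j * max (R.cLow t ω i j - S.c i j) 0 :=
    Finset.sum_nonneg fun i _ => Finset.sum_nonneg fun j _ =>
      mul_nonneg (mul_nonneg (hp.1.1.1 i j).1 (S.lam_nonneg j)) (le_max_right _ _)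
  have hX5 : ∀ i j k, (0 : ℝ) ≤ {ω | S.kap i j k + 2 * radius t < R.kapUp S t ω i j k}.indicator
    (fun _ => (1 : ℝ)) ω := fun i j k => hind _ _
  have hX5s := Finset.sum_nonneg fun (i : Fin N) (_ : i ∈ Finset.univ) =>
    Finset.sum_nonneg fun (j : Fin M) (_ : j ∈ Finset.univ) =>
      Finset.sum_nonneg fun (k : Fin K) (_ : k ∈ Finset.univ) => hX5 i j k
  have hW : 0 ≤ ∑ i, ∑ j, R.phat t ω i j * S.lam j *
      AdaptiveSample.width (R.hit i j) (fun t ω => R.C t ω i j) (S.c i j) (Real.log T) t ω :=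
    Finset.sum_nonneg fun i _ => Finset.sum_nonneg fun j _ =>
      mul_nonneg (mul_nonneg (hopt.1.1.1 i j).1 (S.lam_nonneg j))
        (AdaptiveSample.width_nonneg _ _ _)
  by_cases hbad : ∃ i j k, S.kap i j k + 2 * radius t < R.kapUp S t ω i j k
  · obtain ⟨i, j, k, hijk⟩ := hbad
    have h1 : 1 ≤ ∑ i, ∑ j, ∑ k,
        {ω | S.kap i j k + 2 * radius t < R.kapUp S t ω i j k}.indicator (fun _ => (1 : ℝ)) ω := by
      refine le_trans ?_ (Finset.single_le_sum (fun i _ => Finset.sum_nonneg fun j _ =>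
        Finset.sum_nonneg fun k _ => hX5 i j k) (Finset.mem_univ i))
      refine le_trans ?_ (Finset.single_le_sum (fun j _ =>
        Finset.sum_nonneg fun k _ => hX5 i j k) (Finset.mem_univ j))
      refine le_trans ?_ (Finset.single_le_sum (fun k _ => hX5 i j k) (Finset.mem_univ k))
      rw [Set.indicator_of_mem (by exact hijk)]
    have h2 := (excess_mem hA ht1 hp.1.1 ω).2
    rw [slack]
    linarith
  · push Not at hbad
    have hc : ∀ i j, R.cLow t ω i j ∈ Set.Icc (0 : ℝ) 1 := fun i j => by
      have hm := (hA.sample_cost h i j).obsMean_mem t ω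
      rw [cLow_eq]
      exact ⟨lcb_nonneg, (lcb_le_self hm).trans hm.2⟩
    have hs : ∑ j, R.lamLow t ω j ≤ 1 :=
      (Finset.sum_le_sum fun j _ => hlam1 j).trans (sum_lamHat ht ω).le
    have hrej : ∀ j k, R.kapUp S t ω S.rej j k = 0 := fun j k => by
      simp [kapUp, S.beta_rej k]
    have key := meanCost_sub_le S hc hlam0 hs hrej (by linarith : 0 ≤ 2 * radius t) hbad hopt
      hp.1.1 hp.1.2
    have hA1 : ∑ j ∈ Finset.univ.erase S.nul, max (S.lam j - R.lamLow t ω j) 0 ≤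
        ∑ j ∈ Finset.univ.erase S.nul, (2 * radius t +
          {ω | R.lamLow t ω j < S.lam j - 2 * radius t}.indicator (fun _ => (1 : ℝ)) ω) := by
      refine Finset.sum_le_sum fun j _ => max_le ?_ (add_nonneg (by linarith) (hind _ _))
      by_cases hj : R.lamLow t ω j < S.lam j - 2 * radius t
      · rw [Set.indicator_of_mem (by exact hj)]
        linarith [hlam0 j, (S.lam_mem j).2]
      · linarith [hind {ω | R.lamLow t ω j < S.lam j - 2 * radius t} ω]
    have hC1 : ∑ j, max (R.lamLow t ω j - S.lam j) 0 ≤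
        ∑ j, {ω | S.lam j < R.lamLow t ω j}.indicator (fun _ => (1 : ℝ)) ω := by
      refine Finset.sum_le_sum fun j _ => max_le ?_ (hind _ _)
      by_cases hj : S.lam j < R.lamLow t ω j
      · rw [Set.indicator_of_mem (by exact hj)]
        linarith [hlam1 j, (hlamHat j).2, (S.lam_mem j).1]
      · linarith [hind {ω | S.lam j < R.lamLow t ω j} ω]
    have hA2 : ∑ i, ∑ j, R.phat t ω i j * S.lam j * max (S.c i j - R.cLow t ω i j) 0 ≤
        ∑ i, ∑ j, R.phat t ω i j * S.lam j *
        AdaptiveSample.width (R.hit i j) (fun t ω => R.C t ω i j) (S.c i j) (Real.log T) t ω := by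
      refine Finset.sum_le_sum fun i _ => Finset.sum_le_sum fun j _ =>
        mul_le_mul_of_nonneg_left ?_ (mul_nonneg (hopt.1.1.1 i j).1 (S.lam_nonneg j))
      rw [cLow_eq]
      exact (hA.sample_cost h i j).max_sub_lcb_le_width ht1 htT ω
    rw [slack]
    rw [excess]
    linarith

lemma meanLE_slack (h : R.IsEnvironment S ℱ P) (hA : R.FollowsBaseAlgorithm S ℱ P)
    (ht : 2 ≤ t) {pstar : Fin N → Fin M → ℝ} (hp : pstar ∈ strategies N M) :
    MeanLE P (slack S R pstar t)
      (((M - 1) * √2 + M * √2 + 5 / 2) * (√(Real.log t) * (√(t : ℝ))⁻¹) +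
        ((M - 1) + M + N * M * K) * (2 / t)) := by
  have hM : 1 ≤ M := Fin.pos S.nul
  have h1 := MeanLE.sum (Finset.univ.erase S.nul) fun j _ =>
    (MeanLE.const (P := P) (2 * radius t)).add (MeanLE.indicator (measureReal_lamLow_lt h ht j))
  have h3 := MeanLE.sum Finset.univ fun j _ => MeanLE.indicator (measureReal_lt_lamLow h ht j)
  have h4 := MeanLE.sum (P := P) Finset.univ fun i _ => MeanLE.sum Finset.univ fun j _ =>
    ((hA.sample_cost h i j).meanLE_lcb_sub ht).const_mul
      (mul_nonneg (hp.1 i j).1 (S.lam_nonneg j))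
  have h5 := MeanLE.sum Finset.univ fun i _ => MeanLE.sum Finset.univ fun j _ =>
    MeanLE.sum Finset.univ fun k _ => MeanLE.indicator (measureReal_lt_kapUp h ht i j k)
  refine ((((h1.add (MeanLE.const (M * (2 * radius t)))).add h3).add h4).add h5).mono
    (fun ω => ?_) (le_of_eq ?_)
  · simp only [slack, cLow_eq]
    exact le_rfl
  · simp only [← Finset.sum_mul]
    have e : ∑ i, ∑ j, pstar i j * S.lam j = 1 := by rw [sum_strategy_mul hp, S.lam_sum]
    rw [e]
    simp only [Finset.sum_const, Finset.card_erase_of_mem (Finset.mem_univ _), Finset.card_univ,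
      Fintype.card_fin, nsmul_eq_mul, two_mul_radius]
    push_cast [hM]
    ring

end Run

lemma sum_Ico_one_inv_le (T : ℕ) : ∑ t ∈ Finset.Ico 1 (T + 1), ((t : ℝ))⁻¹ ≤ 1 + Real.log T := by
  have h := sum_range_inv_succ_le (le_refl T)
  rw [Finset.sum_Ico_eq_sum_range]
  refine le_trans (le_of_eq ?_) h
  simp only [Nat.add_sub_cancel]
  exact Finset.sum_congr rfl fun k _ => by push_cast; rw [add_comm]

lemma sum_Ico_two_inv_le {T : ℕ} (hT : 1 ≤ T) :
    ∑ t ∈ Finset.Ico 2 (T + 1), ((t : ℝ))⁻¹ ≤ Real.log T := by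
  have h := sum_Ico_one_inv_le T
  rw [Finset.sum_eq_sum_Ico_succ_bot (by omega)] at h
  norm_num at h
  linarith

lemma sum_Ico_two_rate_le (T : ℕ) :
    ∑ t ∈ Finset.Ico 2 (T + 1), √(Real.log t) * (√(t : ℝ))⁻¹ ≤
      2 * (√(Real.log T) * √(T : ℝ)) := by
  calc ∑ t ∈ Finset.Ico 2 (T + 1), √(Real.log t) * (√(t : ℝ))⁻¹
      ≤ ∑ t ∈ Finset.Ico 2 (T + 1), √(Real.log T) * (√(t : ℝ))⁻¹ := by
        refine Finset.sum_le_sum fun t ht => mul_le_mul_of_nonneg_right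
          (Real.sqrt_le_sqrt (Real.log_le_log ?_ ?_)) (by positivity)
        · have := (Finset.mem_Ico.1 ht).1
          exact_mod_cast (by omega : 0 < t)
        · exact_mod_cast Nat.lt_succ_iff.1 (Finset.mem_Ico.1 ht).2
    _ ≤ √(Real.log T) * ∑ t ∈ Finset.range (T + 1), (√(t : ℝ))⁻¹ := by
        rw [← Finset.mul_sum]
        refine mul_le_mul_of_nonneg_left (Finset.sum_le_sum_of_subset_of_nonneg (fun n hn =>
          Finset.mem_range.2 (Finset.mem_Ico.1 hn).2) fun _ _ _ => by positivity) (by positivity)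
    _ ≤ √(Real.log T) * (2 * √(T : ℝ)) :=
        mul_le_mul_of_nonneg_left (sum_range_succ_inv_sqrt_le T) (by positivity)
    _ = _ := by ring

namespace Run

variable {N M K : ℕ} {Ω : Type*} [mΩ : MeasurableSpace Ω] {P : Measure Ω}
  {S : System N M K} {ℱ : Filtration ℕ mΩ} {R : Run N M K Ω} {t T : ℕ}

lemma regret_eq (pstar : Fin N → Fin M → ℝ) (T : ℕ) :
    R.regret S P pstar T = ∑ t ∈ Finset.Ico 1 (T + 1), ∫ ω, excess S R pstar t ω ∂P := by
  rw [regret]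
  exact Finset.sum_congr (by ext; simp) fun _ _ => rfl

/-- Expected loss in slot `t` due to the uncertainty on the cost of class `j` at node `i`. -/
noncomputable def costLoss (S : System N M K) (R : Run N M K Ω) (P : Measure Ω) (L : ℝ) (i : Fin N)
    (j : Fin M) (t : ℕ) : ℝ :=
  ∫ ω, (R.hit i j t ω : ℝ) *
    AdaptiveSample.width (R.hit i j) (fun t ω => R.C t ω i j) (S.c i j) L t ω ∂P

lemma costLoss_nonneg (L : ℝ) (i : Fin N) (j : Fin M) (t : ℕ) : 0 ≤ costLoss S R P L i j t :=
  integral_nonneg fun _ => mul_nonneg (Nat.cast_nonneg _) (AdaptiveSample.width_nonneg _ _ _)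

variable [IsProbabilityMeasure P]

lemma integrable_hit_mul_width (h : R.IsEnvironment S ℱ P) (hA : R.FollowsBaseAlgorithm S ℱ P)
    (L : ℝ) (i : Fin N) (j : Fin M) (ht : 1 ≤ t) :
    Integrable (fun ω => (R.hit i j t ω : ℝ) *
      AdaptiveSample.width (R.hit i j) (fun t ω => R.C t ω i j) (S.c i j) L t ω) P := by
  have hs := hA.sample_cost h i j
  refine integrable_of_abs_le (b := 1 * (2 + √(L / 2))) (Measurable.mul
    (measurable_from_top.comp ((hs.measurable_B t ht).mono (ℱ.le _) le_rfl))
    ((hs.measurable_width L t).mono (ℱ.le t) le_rfl)) fun ω => ?_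
  rw [abs_of_nonneg (mul_nonneg (Nat.cast_nonneg _) (AdaptiveSample.width_nonneg _ _ _))]
  exact mul_le_mul (by exact_mod_cast hs.B_le t ht ω) (hs.width_le L t ω)
    (AdaptiveSample.width_nonneg _ _ _) zero_le_one

lemma integral_excess_le (h : R.IsEnvironment S ℱ P) (hA : R.FollowsBaseAlgorithm S ℱ P)
    (ht : 2 ≤ t) (htT : t ≤ T) {pstar : Fin N → Fin M → ℝ}
    (hp : IsOptimal S.c S.lam S.kap pstar) :
    ∫ ω, excess S R pstar t ω ∂P ≤
      ((M - 1) * √2 + M * √2 + 5 / 2) * (√(Real.log t) * (√(t : ℝ))⁻¹) +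
        ((M - 1) + M + N * M * K) * (2 / t) +
      ∑ i, ∑ j, costLoss S R P (Real.log T) i j t := by
  have ht1 : 1 ≤ t := by omega
  set w : Fin N → Fin M → Ω → ℝ := fun i j => AdaptiveSample.width (R.hit i j)
    (fun t ω => R.C t ω i j) (S.c i j) (Real.log T) t with hw
  have hwm : ∀ i j, Measurable[ℱ t] (w i j) := fun i j =>
    (hA.sample_cost h i j).measurable_width _ t
  have hwb : ∀ i j ω, |w i j ω| ≤ 2 + √(Real.log T / 2) := fun i j ω => by
    rw [hw, abs_of_nonneg (AdaptiveSample.width_nonneg _ _ _)]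
    exact (hA.sample_cost h i j).width_le _ t ω
  have hterm : ∀ i j, MeanLE P (fun ω => R.phat t ω i j * S.lam j * w i j ω)
      (costLoss S R P (Real.log T) i j t) := by
    intro i j
    have hint : Integrable (fun ω => w i j ω * R.phat t ω i j) P :=
      integrable_of_abs_le (b := (2 + √(Real.log T / 2)) * 1)
        (((hwm i j).mul (hA.measurable_phat_apply ht1 i j)).mono (ℱ.le t) le_rfl) fun ω => by
          rw [abs_mul]
          exact mul_le_mul (hwb i j ω) (hA.abs_phat_le ht1 ω i j) (abs_nonneg _) (by positivity)
    refine ((MeanLE.of_integrable hint).const_mul (S.lam_nonneg j)).mono (fun ω => ?_) ?_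
    · exact le_of_eq (by ring)
    · rw [mul_comm, ← hA.integral_mul_hit h ht1 i j (hwm i j) (hwb i j), costLoss]
      exact le_of_eq (integral_congr_ae (Filter.Eventually.of_forall fun ω => mul_comm _ _))
  exact (((meanLE_slack h hA ht hp.1.1).add (MeanLE.sum Finset.univ fun i _ =>
    MeanLE.sum Finset.univ fun j _ => hterm i j)).mono (excess_le h hA ht htT hp)
      le_rfl).integral_le (integrable_excess hA ht1 pstar)

lemma sum_costLoss_le (h : R.IsEnvironment S ℱ P) (hA : R.FollowsBaseAlgorithm S ℱ P)
    (hT : 1 ≤ T) {ε η L : ℝ} (hε : 0 < ε) (hη : 0 < η) :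
    ∑ t ∈ Finset.Ico 1 (T + 1), ∑ i, ∑ j, costLoss S R P L i j t ≤
      N * M * 2 + √(L / 2) * (η * T + N * M / η) + ε * (N * M * ((1 + Real.log T) / 4)) +
        T * (1 / (2 * ε)) := by
  set F : Fin N → Fin M → ℕ → Ω → ℝ := fun i j t ω => (R.hit i j t ω : ℝ) *
    AdaptiveSample.width (R.hit i j) (fun t ω => R.C t ω i j) (S.c i j) L t ω with hF
  have hint : ∀ t ∈ Finset.Ico 1 (T + 1), ∀ i j, Integrable (F i j t) P := fun t ht i j =>
    integrable_hit_mul_width h hA L i j (Finset.mem_Ico.1 ht).1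
  have e : ∑ t ∈ Finset.Ico 1 (T + 1), ∑ i, ∑ j, costLoss S R P L i j t =
      ∫ ω, ∑ i, ∑ j, ∑ t ∈ Finset.Ico 1 (T + 1), F i j t ω ∂P := by
    rw [integral_finsetSum _ fun i _ => integrable_finsetSum _ fun j _ =>
      integrable_finsetSum _ fun t ht => hint t ht i j, Finset.sum_comm]
    refine Finset.sum_congr rfl fun i _ => ?_
    rw [integral_finsetSum _ fun j _ => integrable_finsetSum _ fun t ht => hint t ht i j,
      Finset.sum_comm]
    refine Finset.sum_congr rfl fun j _ => ?_
    rw [integral_finsetSum _ fun t ht => hint t ht i j]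
    rfl
  rw [e]
  have hsq := (MeanLE.sum (P := P) Finset.univ fun i _ => MeanLE.sum Finset.univ fun j _ =>
    (hA.sample_cost h i j).meanLE_sqDev hT).const_mul hε.le
  refine MeanLE.integral_le (((MeanLE.const (N * M * 2 + √(L / 2) * (η * T + N * M / η) +
    T * (1 / (2 * ε)))).add hsq).mono (fun ω => ?_) (le_of_eq ?_))
    (integrable_finsetSum _ fun i _ => integrable_finsetSum _ fun j _ =>
      integrable_finsetSum _ fun t ht => hint t ht i j)
  · have hpt : ∀ i j, ∑ t ∈ Finset.Ico 1 (T + 1), F i j t ω ≤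
        2 + √(L / 2) * (η * obsCount (R.hit i j) (T + 1) ω + 1 / η) +
        ε * AdaptiveSample.sqDev (R.hit i j) (fun t ω => R.C t ω i j) (S.c i j) (T + 1) ω +
        obsCount (R.hit i j) (T + 1) ω * (1 / (2 * ε)) := by
      intro i j
      refine ((hA.sample_cost h i j).sum_width_le hε (T + 1) (by omega) ω).trans ?_
      have h1 : 2 * √(obsCount (R.hit i j) (T + 1) ω : ℝ) ≤
          η * obsCount (R.hit i j) (T + 1) ω + 1 / η := by
        have hn : (0 : ℝ) ≤ obsCount (R.hit i j) (T + 1) ω := Nat.cast_nonneg _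
        have h2 := Real.sq_sqrt hn
        have h3 : η * √(obsCount (R.hit i j) (T + 1) ω : ℝ) ^ 2 + 1 / η -
            2 * √(obsCount (R.hit i j) (T + 1) ω : ℝ) =
            (η * √(obsCount (R.hit i j) (T + 1) ω : ℝ) - 1) ^ 2 / η := by
          field_simp; ring
        have h4 : 0 ≤ (η * √(obsCount (R.hit i j) (T + 1) ω : ℝ) - 1) ^ 2 / η := by positivity
        rw [h2] at h3
        linarith
      have h5 := mul_le_mul_of_nonneg_left h1 (Real.sqrt_nonneg (L / 2))
      linarith
    refine (Finset.sum_le_sum fun i _ => Finset.sum_le_sum fun j _ => hpt i j).trans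
      (le_of_eq ?_)
    have hc := sum_obsCount_hit (R := R) T ω
    simp only [Finset.sum_add_distrib, ← Finset.mul_sum, ← Finset.sum_mul, hc, Finset.sum_const,
      Finset.card_univ, Fintype.card_fin, nsmul_eq_mul]
    ring
  · simp only [Finset.sum_const, Finset.card_univ, Fintype.card_fin, nsmul_eq_mul]
    ring

lemma sum_integral_excess_le (h : R.IsEnvironment S ℱ P) (hA : R.FollowsBaseAlgorithm S ℱ P)
    (hT : 1 ≤ T) {ε η : ℝ} (hε : 0 < ε) (hη : 0 < η) {pstar : Fin N → Fin M → ℝ}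
    (hp : IsOptimal S.c S.lam S.kap pstar) :
    R.regret S P pstar T ≤ 1 +
      ((M - 1) * √2 + M * √2 + 5 / 2) * (2 * (√(Real.log T) * √(T : ℝ))) +
      ((M - 1) + M + N * M * K) * (2 * Real.log T) +
      (N * M * 2 + √(Real.log T / 2) * (η * T + N * M / η) +
        ε * (N * M * ((1 + Real.log T) / 4)) + T * (1 / (2 * ε))) := by
  have hM : (1 : ℝ) ≤ M := by exact_mod_cast Fin.pos S.nul
  have hloss := sum_costLoss_le h hA hT (L := Real.log T) hε hη
  have hnn : ∀ t, 0 ≤ ∑ i, ∑ j, costLoss S R P (Real.log T) i j t := fun t =>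
    Finset.sum_nonneg fun i _ => Finset.sum_nonneg fun j _ => costLoss_nonneg _ i j t
  have hfirst : ∫ ω, excess S R pstar 1 ω ∂P ≤ 1 := by
    refine (integral_mono (integrable_excess hA le_rfl pstar) (integrable_const 1)
      fun ω => (excess_mem hA le_rfl hp.1.1 ω).2).trans ?_
    simp
  rw [Finset.sum_eq_sum_Ico_succ_bot (by omega)] at hloss
  have hrest := Finset.sum_le_sum fun t (ht : t ∈ Finset.Ico 2 (T + 1)) =>
    integral_excess_le h hA (Finset.mem_Ico.1 ht).1 (Nat.lt_succ_iff.1 (Finset.mem_Ico.1 ht).2) hp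
  rw [regret_eq, Finset.sum_eq_sum_Ico_succ_bot (by omega)]
  simp only [div_eq_mul_inv (2 : ℝ)] at hrest
  simp only [Finset.sum_add_distrib, ← Finset.mul_sum] at hrest
  have h1 := mul_le_mul_of_nonneg_left (sum_Ico_two_rate_le T)
    (by have := sub_nonneg.2 hM; positivity : (0 : ℝ) ≤ (M - 1) * √2 + M * √2 + 5 / 2)
  have h2 := mul_le_mul_of_nonneg_left (mul_le_mul_of_nonneg_left (sum_Ico_two_inv_le hT)
    zero_le_two) (by have := sub_nonneg.2 hM; positivity : (0 : ℝ) ≤ (M - 1) + M + N * M * K)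
  have h3 := hnn 1
  rw [one_add_one_eq_two] at hloss ⊢
  linarith

end Run

/-- The regret bound of the base algorithm, not divided by the horizon. -/
noncomputable def regretBound (N M K T : ℕ) : ℝ :=
  N * M * (2 * (√2 + 1) * √(T * Real.log T) + 6 * K * (1 + Real.log T))

lemma regretBound_nonneg {N M K T : ℕ} : 0 ≤ regretBound N M K T := by
  have : 0 ≤ Real.log T := Real.log_natCast_nonneg T
  unfold regretBound
  positivity

lemma eventually_log_le_sqrt (K : ℕ) :
    ∀ᶠ T : ℕ in Filter.atTop, 6 * K * (1 + Real.log T) ≤ √(T * Real.log T) := by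
  have hlog : Filter.Tendsto (fun T : ℕ => Real.log T) Filter.atTop Filter.atTop :=
    Real.tendsto_log_atTop.comp tendsto_natCast_atTop_atTop
  have hlittle := (Real.isLittleO_log_id_atTop.comp_tendsto
    tendsto_natCast_atTop_atTop).def (by positivity : (0 : ℝ) < 1 / (144 * K ^ 2 + 1))
  filter_upwards [hlog.eventually_ge_atTop 1, hlittle] with T h1 h2
  simp only [Function.comp_apply, id_eq, Real.norm_eq_abs, Nat.abs_cast] at h2
  rw [abs_of_nonneg (by linarith), one_div, inv_mul_eq_div, le_div_iff₀ (by positivity)] at h2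
  have hK : (0 : ℝ) ≤ K := Nat.cast_nonneg K
  refine Real.le_sqrt_of_sq_le ?_
  have h3 : 6 * (K : ℝ) * (1 + Real.log T) ≤ 12 * K * Real.log T := by nlinarith
  calc (6 * (K : ℝ) * (1 + Real.log T)) ^ 2 ≤ (12 * K * Real.log T) ^ 2 :=
        pow_le_pow_left₀ (by positivity) h3 2
    _ = Real.log T * (144 * K ^ 2) * Real.log T := by ring
    _ ≤ T * Real.log T := mul_le_mul_of_nonneg_right (by linarith) (by linarith)

namespace Run

variable {N M K : ℕ} {Ω : Type*} [mΩ : MeasurableSpace Ω] {P : Measure Ω}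
  {S : System N M K} {ℱ : Filtration ℕ mΩ} {R : Run N M K Ω} {T : ℕ}
  {pstar : Fin N → Fin M → ℝ}

lemma regret_eq_zero (hA : R.FollowsBaseAlgorithm S ℱ P)
    (hp : pstar ∈ strategies N M) (hNM : N = 1 ∨ M = 1) : R.regret S P pstar T = 0 := by
  rw [regret]
  refine Finset.sum_eq_zero fun t ht => ?_
  have hz : ∀ ω, meanCost (R.phat t ω) S.c S.lam - meanCost pstar S.c S.lam = 0 := by
    intro ω
    rw [sub_eq_zero]
    rcases hNM with rfl | rfl
    · exact meanCost_eq_of_one_node S (hA.optimal t (Finset.mem_Icc.1 ht).1 ω).1.1 hp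
    · exact meanCost_eq_of_one_class S _ _
  simp [hz]

variable [IsProbabilityMeasure P]

lemma regret_le (hK : 1 ≤ K) (h : R.IsEnvironment S ℱ P) (hA : R.FollowsBaseAlgorithm S ℱ P)
    (hT : 1 ≤ T) (hp : IsOptimal S.c S.lam S.kap pstar) :
    R.regret S P pstar T ≤ regretBound N M K T := by
  have hN : 1 ≤ N := Fin.pos S.rej
  have hM : 1 ≤ M := Fin.pos S.nul
  by_cases hNM : N = 1 ∨ M = 1
  · rw [regret_eq_zero hA hp.1.1 hNM]
    exact regretBound_nonneg
  push Not at hNM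
  have hN2 : (2 : ℝ) ≤ N := by exact_mod_cast (by omega : 2 ≤ N)
  have hM2 : (2 : ℝ) ≤ M := by exact_mod_cast (by omega : 2 ≤ M)
  have hK1 : (1 : ℝ) ≤ K := by exact_mod_cast hK
  have hT0 : (0 : ℝ) < T := by exact_mod_cast hT
  have hmM : 2 * (M : ℝ) ≤ N * M := mul_le_mul_of_nonneg_right hN2 (by linarith)
  set m : ℝ := N * M with hm
  have hm4 : 4 ≤ m := by linarith
  have hKm : m ≤ m * K := le_mul_of_one_le_right (by linarith) hK1
  rcases eq_or_lt_of_le hT with h1 | h1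
  · subst h1
    have h2 : R.regret S P pstar 1 ≤ 1 := by
      rw [regret_eq]
      simp only [Nat.Ico_succ_singleton, Finset.sum_singleton]
      refine (integral_mono (integrable_excess hA le_rfl pstar) (integrable_const 1)
        fun ω => (excess_mem hA le_rfl hp.1.1 ω).2).trans ?_
      simp
    rw [regretBound]
    simp only [Nat.cast_one, Real.log_one, mul_zero, Real.sqrt_zero, zero_add, add_zero, mul_one]
    linarith
  have hL2 : Real.log 2 ≤ Real.log T := Real.log_le_log (by norm_num) (by exact_mod_cast h1)
  have hd9 := Real.log_two_gt_d9
  set L := Real.log T with hL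
  have hL0 : 0 < L := by linarith
  set a := √L with ha
  set b := √(T : ℝ) with hb
  have ha0 : 0 < a := Real.sqrt_pos.2 hL0
  have hb0 : 0 < b := Real.sqrt_pos.2 hT0
  have ha2 : a ^ 2 = L := Real.sq_sqrt hL0.le
  have hb2 : b ^ 2 = T := Real.sq_sqrt hT0.le
  have hs0 : (0 : ℝ) < √2 := by positivity
  have hs2 : √(2 : ℝ) ^ 2 = 2 := Real.sq_sqrt (by norm_num)
  have hs_lo : (1.414 : ℝ) ≤ √2 := Real.le_sqrt_of_sq_le (by norm_num)
  have hs_hi : √2 ≤ (1.4143 : ℝ) := Real.sqrt_le_iff.2 (by norm_num)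
  have hX : √(T * L) = a * b := by rw [Real.sqrt_mul hT0.le, mul_comm]
  have key := sum_integral_excess_le h hA hT (ε := b / (2 * a)) (η := 2 / b) (by positivity)
    (by positivity) hp
  rw [← hL, ← ha, ← hb, ← hm] at key
  have hX0 : 0 < a * b := mul_pos ha0 hb0
  have t1 : √(L / 2) * (2 / b * T + m / (2 / b)) ≤ 0.7072 * (m * (a * b)) := by
    have e1 : √(L / 2) = a * (√2 / 2) := by
      rw [Real.sqrt_div hL0.le, ← ha]; field_simp; linarith
    have e2 : 2 / b * T + m / (2 / b) = b * (2 + m / 2) := by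
      rw [← hb2]; field_simp
    have h5 : √2 / 2 * (2 + m / 2) ≤ 0.7072 * m :=
      (mul_le_mul (by linarith : √2 / 2 ≤ 0.7072) (by linarith : 2 + m / 2 ≤ m) (by linarith)
        (by norm_num))
    rw [e1, e2]
    refine le_trans (le_of_eq ?_) ((mul_le_mul_of_nonneg_right h5 hX0.le).trans (le_of_eq ?_)) <;>
      ring
  have t2 : b / (2 * a) * (m * ((1 + L) / 4)) ≤ 0.3056 * (m * (a * b)) := by
    have h5 : 1 + L ≤ 2.4448 * L := by linarith
    have e : b / (2 * a) * (m * ((1 + L) / 4)) = m * b / (8 * a) * (1 + L) := by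
      field_simp; ring
    rw [e]
    refine (mul_le_mul_of_nonneg_left h5 (by positivity)).trans (le_of_eq ?_)
    rw [← ha2]; field_simp; ring
  have t3 : T * (1 / (2 * (b / (2 * a)))) ≤ 0.25 * (m * (a * b)) := by
    have e : (T : ℝ) * (1 / (2 * (b / (2 * a)))) = a * b := by
      rw [← hb2]; field_simp
    rw [e]
    nlinarith
  have t4 : ((M - 1) * √2 + M * √2 + 5 / 2) * (2 * (a * b)) ≤
      (2 * √2 + 0.544) * (m * (a * b)) := by
    have h6 : ((M - 1) * √2 + M * √2 + 5 / 2) * 2 ≤ (2 * √2 + 0.544) * m := by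
      have h7 := mul_le_mul_of_nonneg_right hmM hs0.le
      linarith
    calc _ = ((M - 1) * √2 + M * √2 + 5 / 2) * 2 * (a * b) := by ring
      _ ≤ (2 * √2 + 0.544) * m * (a * b) := mul_le_mul_of_nonneg_right h6 hX0.le
      _ = _ := by ring
  have t5 : ((M - 1) + M + m * K) * (2 * L) ≤ 4 * (m * K) * L := by
    have : (M - 1) + M + m * K ≤ 2 * (m * K) := by linarith
    nlinarith
  have hmX : 0 < m * (a * b) := by positivity
  have hKL : 0 ≤ m * K * L := by positivity
  rw [regretBound, ← hL, ← hm, hX]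
  linarith

lemma neg_le_regret (h : R.IsEnvironment S ℱ P) (hA : R.FollowsBaseAlgorithm S ℱ P)
    (hT : 1 ≤ T) (hp : IsOptimal S.c S.lam S.kap pstar) :
    -(1 + N * M * K * (2 * Real.log T)) ≤ R.regret S P pstar T := by
  have hfirst : -1 ≤ ∫ ω, excess S R pstar 1 ω ∂P := by
    refine le_trans (by simp) (integral_mono (integrable_const (-1))
      (integrable_excess hA le_rfl pstar) fun ω => (excess_mem hA le_rfl hp.1.1 ω).1)
  have hrest : ∀ t ∈ Finset.Ico 2 (T + 1),
      -(N * M * K * (2 * (t : ℝ)⁻¹)) ≤ ∫ ω, excess S R pstar t ω ∂P := by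
    intro t ht
    have ht2 := (Finset.mem_Ico.1 ht).1
    have ht1 : 1 ≤ t := by omega
    have hm := (measurableSet_feasible (S := S) hA ht1).compl
    have h1 := measureReal_infeasible_le h hA ht2
    rw [← div_eq_mul_inv]
    refine (neg_le_neg h1).trans ?_
    rw [← integral_indicator_one hm, ← integral_neg]
    refine integral_mono ((integrable_const 1).indicator hm).neg (integrable_excess hA ht1 pstar)
      fun ω => ?_
    by_cases hω : ω ∈ (R.feasible S t)ᶜ
    · simpa [hω] using (excess_mem hA ht1 hp.1.1 ω).1
    · have hf : ω ∈ R.feasible S t := by simpa using hω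
      simp only [Set.indicator_of_notMem hω, neg_zero]
      exact sub_nonneg.2 (hp.2 _ (hA.optimal t ht1 ω).1.1 hf)
  rw [regret_eq, Finset.sum_eq_sum_Ico_succ_bot (by omega), one_add_one_eq_two]
  have h1 := Finset.sum_le_sum hrest
  rw [Finset.sum_neg_distrib, ← Finset.mul_sum, ← Finset.mul_sum] at h1
  have h2 := mul_le_mul_of_nonneg_left (mul_le_mul_of_nonneg_left (sum_Ico_two_inv_le hT)
    zero_le_two) (by positivity : (0 : ℝ) ≤ N * M * K)
  linarith

lemma abs_regret_le (hK : 1 ≤ K) (h : R.IsEnvironment S ℱ P) (hA : R.FollowsBaseAlgorithm S ℱ P)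
    (hT : 1 ≤ T) (hp : IsOptimal S.c S.lam S.kap pstar) :
    |R.regret S P pstar T| ≤ regretBound N M K T := by
  refine abs_le.2 ⟨le_trans (neg_le_neg ?_) (neg_le_regret h hA hT hp), regret_le hK h hA hT hp⟩
  have hL : 0 ≤ Real.log T := Real.log_natCast_nonneg T
  have hNMK : (1 : ℝ) ≤ N * M * K := by
    exact_mod_cast Nat.mul_pos (Nat.mul_pos (Fin.pos S.rej) (Fin.pos S.nul)) hK
  have h1 : 0 ≤ (N : ℝ) * M * (2 * (√2 + 1) * √(T * Real.log T)) := by positivity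
  have h2 : 0 ≤ (N : ℝ) * M * K * Real.log T := by positivity
  rw [regretBound]
  linarith

lemma isBigOWith_regret (hK : 1 ≤ K) (h : R.IsEnvironment S ℱ P)
    (hA : R.FollowsBaseAlgorithm S ℱ P) (hp : IsOptimal S.c S.lam S.kap pstar) :
    Asymptotics.IsBigOWith (2 * (√2 + 1) + 1) Filter.atTop (fun T : ℕ => R.regret S P pstar T)
      (fun T : ℕ => (N : ℝ) * M * √(T * Real.log T)) := by
  refine Asymptotics.IsBigOWith.of_bound ?_
  filter_upwards [eventually_log_le_sqrt K, Filter.eventually_ge_atTop 1] with T h1 h2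
  rw [Real.norm_eq_abs, Real.norm_of_nonneg (by positivity)]
  refine (abs_regret_le hK h hA h2 hp).trans ?_
  rw [regretBound]
  have h3 := mul_le_mul_of_nonneg_left h1 (by positivity : (0 : ℝ) ≤ N * M)
  linarith

lemma tendsto_measureReal_feasible (h : R.IsEnvironment S ℱ P)
    (hA : R.FollowsBaseAlgorithm S ℱ P) :
    Filter.Tendsto (fun T : ℕ => P.real (R.feasible S T)) Filter.atTop (nhds 1) := by
  have hlim : Filter.Tendsto (fun T : ℕ => 1 - (N : ℝ) * M * K * (2 / T)) Filter.atTop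
      (nhds 1) := by
    have := ((tendsto_const_div_atTop_nhds_zero_nat (2 : ℝ)).const_mul
      ((N : ℝ) * M * K)).const_sub 1
    simpa using this
  refine tendsto_of_tendsto_of_tendsto_of_le_of_le' hlim tendsto_const_nhds ?_
    (Filter.Eventually.of_forall fun T => measureReal_le_one)
  filter_upwards [Filter.eventually_ge_atTop 2] with T hT
  exact measureReal_feasible_ge h hA hT

end Run

end Placement

theorem theorem1 : ∃ C₀ : ℝ, ∀ (N M K : ℕ), 1 ≤ K → ∀ (S : Placement.System N M K)
    (Ω : Type*) [MeasurableSpace Ω] (P : Measure Ω) [IsProbabilityMeasure P]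
    (ℱ : Filtration ℕ (inferInstance : MeasurableSpace Ω)) (R : Placement.Run N M K Ω),
    R.IsEnvironment S ℱ P → R.FollowsBaseAlgorithm S ℱ P →
    ∀ pstar : Fin N → Fin M → ℝ, Placement.IsOptimal S.c S.lam S.kap pstar →
      (∀ T : ℕ, 1 ≤ T →
        R.regret S P pstar T / T ≤
          ((N : ℝ) * M / T) * (2 * (√2 + 1) * √(T * Real.log T) + 6 * K * (1 + Real.log T))) ∧
      Asymptotics.IsBigOWith C₀ Filter.atTop (fun T : ℕ => R.regret S P pstar T)
        (fun T : ℕ => (N : ℝ) * M * √(T * Real.log T)) ∧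
      (∀ T : ℕ, 2 ≤ T →
        1 - 6 * (N : ℝ) * M * K * (Real.log T / T) ≤ P.real (R.feasible S T)) ∧
      Filter.Tendsto (fun T : ℕ => P.real (R.feasible S T)) Filter.atTop (nhds 1) := by
  refine ⟨2 * (√2 + 1) + 1, fun N M K hK S Ω _ P _ ℱ R h hA pstar hp =>
    ⟨fun T hT => ?_, Placement.Run.isBigOWith_regret hK h hA hp, fun T hT => ?_,
      Placement.Run.tendsto_measureReal_feasible h hA⟩⟩
  · have h1 := Placement.Run.regret_le hK h hA hT hp
    rw [div_mul_eq_mul_div]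
    exact div_le_div_of_nonneg_right h1 (Nat.cast_nonneg T)
  · refine le_trans ?_ (Placement.Run.measureReal_feasible_ge h hA hT)
    have hlog : Real.log 2 ≤ Real.log T := Real.log_le_log (by norm_num) (by exact_mod_cast hT)
    have hd9 := Real.log_two_gt_d9
    have h1 : 2 / (T : ℝ) ≤ 6 * (Real.log T / T) := by
      rw [← mul_div_assoc]
      exact div_le_div_of_nonneg_right (by linarith) (Nat.cast_nonneg T)
    have h2 := mul_le_mul_of_nonneg_left h1 (by positivity : (0 : ℝ) ≤ N * M * K)
    linarith
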